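/- Let $H$ be a real Hilbert space and let $S(H)=H\times H$ carry the symplectic form $\omega((u_1,v_1),(u_2,v_2))=\langle v_2,u_1\rangle-\langle v_1,u_2\rangle$; write $W^\sharp$ for the $\omega$-orthogonal and $W^\perp$ for the Hilbert orthogonal of a subspace $W$. Let $\Lambda(H)$ be the set of Lagrangian subspaces of $S(H)$ ($L=L^\sharp$) with the gap metric $\|P_L-P_M\|$ ($P_L$ is the orthogonal projector onto $L$), let $H_0=H\times\{0\}$, and let $\Lambda_0(H)\subset\Lambda(H)$ consist of those $L$ for which $(H_0,L)$ is a Fredholm pair ($H_0+L$ is closed and of finite codimension, and $\dim(H_0\cap L)<\infty$). For a finite-dimensional Euclidean space $F$ and $L\in\Lambda(F)$ let $\overline{\det}^2(L)\in S^1$ be $\det(U)^2$, where $U$ is a unitary operator of $F\otimes\mathbb C\cong S(F)$, $u+iv\leftrightarrow(u,v)$, that maps $F_0=F\times\{0\}$ onto $L$. For a path $l\colon[a,b]\to\Lambda(F)$ with endpoints transverse to $F_0$, the Maslov index $m_{F_0}(l)\in\mathbb Z$ is the winding number of $\overline{\det}^2$ along any loop obtained by concatenating $l$ with a path from $l(b)$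 to $l(a)$ consisting of Lagrangian subspaces transverse to $F_0$. Let $\mathcal L\colon[a,b]\to\Lambda_0(H)$ be a continuous path whose endpoints $\mathcal L(a),\mathcal L(b)$ are transverse to $H_0$. Call a closed subspace $I\subset H$ of finite codimension admissible if, for all $t\in[a,b]$, $\mathcal L(t)$ has a clean intersection with $I_0=I\times\{0\}$, that is, $\mathcal L(t)\cap I_0=\{0\}$ and $\mathcal L(t)+I_0$ is closed. For an admissible $I$ and $F=I^\perp$, let $l_I(t)\subset S_{I_0}=I_0^\sharp\cap I_0^\perp=F\times F=S(F)$ be the symplectic reduction of $\mathcal L(t)$ modulo $I_0$, that is, the image of $\mathcal L(t)\cap I_0^\sharp$ under the orthogonal projection onto $S_{I_0}$. Then an admissible $I$ exists; for every admissible $I$, $l_I$ is a continuous path in $\Lambda(F)$ with endpoints transverse to $F_0$, and its Maslov index $m_{F_0}(l_I)$ is well defined; and the integer $m_{F_0}(l_I)$ is the same for all admissible $I$. In other words, the generalized Maslov index $m_{H_0}(\mathcal L):=m_{F_0}(l_I)$ is well defined. -/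

import Mathlib

namespace FredholmMaslov

noncomputable section

/-! ### The canonical symplectic Hilbert space of a real Hilbert space -/

section Symplectic

variable {V : Type*} [NormedAddCommGroup V] [InnerProductSpace ℝ V]

variable (V) in
/-- `S(V) = V × V` with the Hilbert (`ℓ²`) product structure. -/
abbrev SympSpace : Type _ := WithLp 2 (V × V)

/-- The complex structure `J (u, v) = (-v, u)`. -/
def complexJ : SympSpace V ≃ₗ[ℝ] SympSpace V where
  toFun z := WithLp.toLp 2 (-z.snd, z.fst)
  invFun z := WithLp.toLp 2 (z.snd, -z.fst)
  map_add' x y := by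
    apply WithLp.ofLp_injective
    ext <;> simp [add_comm]
  map_smul' c x := by
    apply WithLp.ofLp_injective
    ext <;> simp
  left_inv x := by
    apply WithLp.ofLp_injective
    ext <;> simp
  right_inv x := by
    apply WithLp.ofLp_injective
    ext <;> simp

/-- The symplectic form `ω ((u₁, v₁), (u₂, v₂)) = ⟪v₂, u₁⟫ - ⟪v₁, u₂⟫`. -/
def omega (z w : SympSpace V) : ℝ :=
  inner ℝ w.snd z.fst - inner ℝ z.snd w.fst

theorem omega_eq_inner (z w : SympSpace V) : omega z w = inner ℝ (complexJ z) w := by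
  simp [omega, complexJ, WithLp.prod_inner_apply, real_inner_comm]
  ring

/-- The symplectic orthogonal `W^♯ = {v | ω (u, v) = 0 for all u ∈ W}`. -/
def sharp (W : Submodule ℝ (SympSpace V)) : Submodule ℝ (SympSpace V) where
  carrier := {v | ∀ u ∈ W, omega u v = 0}
  zero_mem' := by
    intro u _
    simp [omega]
  add_mem' := by
    intro a b ha hb u hu
    rw [omega_eq_inner, inner_add_right, ← omega_eq_inner, ← omega_eq_inner, ha u hu, hb u hu,
      add_zero]
  smul_mem' := by
    intro c a ha u hu
    rw [omega_eq_inner, inner_smul_right, ← omega_eq_inner, ha u hu, mul_zero]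

theorem sharp_eq_orthogonal (W : Submodule ℝ (SympSpace V)) :
    sharp W = (W.map complexJ.toLinearMap)ᗮ := by
  ext v
  rw [Submodule.mem_orthogonal]
  constructor
  · rintro h _ ⟨u, hu, rfl⟩
    have := h u hu
    rwa [omega_eq_inner] at this
  · intro h u hu
    rw [omega_eq_inner]
    exact h _ ⟨u, hu, rfl⟩

/-- `L` is Lagrangian: `L = L^♯`. (Such an `L` is automatically closed.) -/
def IsLagrangian (L : Submodule ℝ (SympSpace V)) : Prop := L = sharp L

theorem isClosed_sharp (W : Submodule ℝ (SympSpace V)) :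
    IsClosed (sharp W : Set (SympSpace V)) := by
  rw [sharp_eq_orthogonal]
  exact Submodule.isClosed_orthogonal _

/-- The isotropic subspace `I × {0}` of `S(V)`. -/
def horizontal (I : Submodule ℝ V) : Submodule ℝ (SympSpace V) where
  carrier := {z | z.fst ∈ I ∧ z.snd = 0}
  zero_mem' := by simp
  add_mem' := by
    rintro a b ⟨ha, ha'⟩ ⟨hb, hb'⟩
    exact ⟨by simpa using I.add_mem ha hb, by simp [ha', hb']⟩
  smul_mem' := by
    rintro c a ⟨ha, ha'⟩
    exact ⟨by simpa using I.smul_mem c ha, by simp [ha']⟩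

variable (V) in
/-- The Lagrangian subspace `V₀ = V × {0}` of `S(V)`. -/
abbrev horizontalFrame : Submodule ℝ (SympSpace V) := horizontal (⊤ : Submodule ℝ V)

theorem isLagrangian_horizontalFrame : IsLagrangian (horizontalFrame V) := by
  ext z
  constructor
  · rintro ⟨-, hz⟩ u ⟨-, hu⟩
    simp [omega, hz, hu]
  · intro h
    refine ⟨trivial, ?_⟩
    have := h (WithLp.toLp 2 (z.snd, 0)) ⟨trivial, rfl⟩
    simpa [omega] using this

end Symplectic

/-! ### Pairs of subspaces -/

section Pairs

variable {E : Type*} [NormedAddCommGroup E] [InnerProductSpace ℝ E]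

/-- `(X, Y)` is a Fredholm pair of closed subspaces. -/
structure IsFredholmPair (X Y : Submodule ℝ E) : Prop where
  isClosed_left : IsClosed (X : Set E)
  isClosed_right : IsClosed (Y : Set E)
  isClosed_sup : IsClosed ((X ⊔ Y : Submodule ℝ E) : Set E)
  finite_inf : FiniteDimensional ℝ (X ⊓ Y : Submodule ℝ E)
  finite_quotient : FiniteDimensional ℝ (E ⧸ (X ⊔ Y))

/-- `X` and `Y` have a clean intersection: `X ∩ Y = {0}` and `X + Y` is closed. -/
def HasCleanIntersection (X Y : Submodule ℝ E) : Prop :=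
  X ⊓ Y = ⊥ ∧ IsClosed ((X ⊔ Y : Submodule ℝ E) : Set E)

/-- `X` and `Y` are transverse: `E` is the direct sum of `X` and `Y`. -/
def IsTransverse (X Y : Submodule ℝ E) : Prop := IsCompl X Y

end Pairs

/-! ### The Lagrangian Grassmannian with the gap metric -/

section Grassmannian

variable {V : Type*} [NormedAddCommGroup V] [InnerProductSpace ℝ V]

variable (V) in
/-- The set `Λ(V)` of all Lagrangian subspaces of `S(V)`. -/
def LagrangianGrassmannian : Type _ := {L : Submodule ℝ (SympSpace V) // IsLagrangian L}

namespace LagrangianGrassmannian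

/-- The underlying subspace of a point of `Λ(V)`. -/
def space (L : LagrangianGrassmannian V) : Submodule ℝ (SympSpace V) := L.1

theorem isClosed_space (L : LagrangianGrassmannian V) : IsClosed (L.space : Set (SympSpace V)) := by
  have h : L.space = sharp L.space := L.2
  rw [h]
  exact isClosed_sharp _

instance [CompleteSpace V] (L : LagrangianGrassmannian V) : CompleteSpace L.space :=
  L.isClosed_space.completeSpace_coe

/-- The orthogonal projector `P_L` of `S(V)` onto `L`. -/
def projector [CompleteSpace V] (L : LagrangianGrassmannian V) : SympSpace V →L[ℝ] SympSpace V :=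
  L.space.starProjection

theorem projector_injective [CompleteSpace V] :
    Function.Injective (projector : LagrangianGrassmannian V → _) := by
  intro L M h
  exact Subtype.ext ((Submodule.starProjection_inj (U := L.space) (V := M.space)).mp h)

/-- The gap metric `d (L, M) = ‖P_L - P_M‖`. -/
instance [CompleteSpace V] : MetricSpace (LagrangianGrassmannian V) :=
  MetricSpace.induced projector projector_injective inferInstance

theorem dist_eq [CompleteSpace V] (L M : LagrangianGrassmannian V) :
    dist L M = ‖L.projector - M.projector‖ :=
  dist_eq_norm L.projector M.projector

end LagrangianGrassmannian

variable (V) in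
/-- The Lagrangian subspace `V₀ = V × {0}` of `S(V)`, as a point of `Λ(V)`. -/
def frameLagrangian : LagrangianGrassmannian V :=
  ⟨horizontalFrame V, isLagrangian_horizontalFrame⟩

variable (V) in
/-- The Fredholm Lagrangian Grassmannian `Λ₀(V)`: all `L ∈ Λ(V)` such that `(V₀, L)` is a
Fredholm pair. -/
def fredholmLagrangianGrassmannian : Set (LagrangianGrassmannian V) :=
  {L | IsFredholmPair (horizontalFrame V) L.space}

end Grassmannian

/-! ### Symplectic reduction -/

section Reduction

variable {V : Type*} [NormedAddCommGroup V] [InnerProductSpace ℝ V]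

/-- The symplectic reduction `S_I = I^♯ ∩ I^⊥` of `S(V)` modulo `I`. -/
def reducedSpace (I : Submodule ℝ (SympSpace V)) : Submodule ℝ (SympSpace V) := sharp I ⊓ Iᗮ

instance [CompleteSpace V] (I : Submodule ℝ (SympSpace V)) : CompleteSpace (reducedSpace I) :=
  IsComplete.completeSpace_coe (s := (reducedSpace I : Set (SympSpace V)))
    ((isClosed_sharp I).inter (Submodule.isClosed_orthogonal I)).isComplete

/-- The symplectic reduction `L_I` of `L` modulo `I`: the image of `L ∩ I^♯` by the orthogonal
projection onto `S_I`. -/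
def reduction [CompleteSpace V] (I L : Submodule ℝ (SympSpace V)) : Submodule ℝ (SympSpace V) :=
  (L ⊓ sharp I).map (reducedSpace I).starProjection.toLinearMap

/-- The inclusion of `S(F) = F × F` into `S(V)`, for a subspace `F` of `V`. -/
def inclusion (F : Submodule ℝ V) : SympSpace F →ₗ[ℝ] SympSpace V where
  toFun z := WithLp.toLp 2 ((z.fst : V), (z.snd : V))
  map_add' x y := by
    apply WithLp.ofLp_injective
    ext <;> simp
  map_smul' c x := by
    apply WithLp.ofLp_injective
    ext <;> simp

/-- For `I₀ = I × {0}` and `F = I^⊥` one has `S_{I₀} = F × F`. -/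
theorem reducedSpace_horizontal (I : Submodule ℝ V) :
    reducedSpace (horizontal I) = LinearMap.range (inclusion Iᗮ) := by
  ext z
  constructor
  · rintro ⟨h1, h2⟩
    have hs : z.snd ∈ Iᗮ := by
      rw [Submodule.mem_orthogonal]
      intro u hu
      have := h1 (WithLp.toLp 2 (u, 0)) ⟨hu, rfl⟩
      simpa [omega, real_inner_comm] using this
    have hf : z.fst ∈ Iᗮ := by
      rw [Submodule.mem_orthogonal]
      intro u hu
      have := (Submodule.mem_orthogonal _ _).1 h2 (WithLp.toLp 2 (u, 0)) ⟨hu, rfl⟩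
      simpa [WithLp.prod_inner_apply] using this
    exact ⟨WithLp.toLp 2 (⟨z.fst, hf⟩, ⟨z.snd, hs⟩), rfl⟩
  · rintro ⟨w, rfl⟩
    refine ⟨?_, ?_⟩
    · rintro u ⟨hu, hu'⟩
      have := (Submodule.mem_orthogonal _ _).1 w.snd.2 _ hu
      simpa [omega, inclusion, hu', real_inner_comm] using this
    · refine (Submodule.mem_orthogonal _ _).2 ?_
      rintro u ⟨hu, hu'⟩
      have := (Submodule.mem_orthogonal _ _).1 w.fst.2 _ hu
      simpa [WithLp.prod_inner_apply, inclusion, hu'] using this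

/-- The symplectic reduction of `L` modulo `I₀ = I × {0}`, as a subspace of `S(F)`, `F = I^⊥`,
under the identification of `S_{I₀} = F × F` with `S(F)`. -/
def horizontalReduction [CompleteSpace V] (I : Submodule ℝ V) (L : Submodule ℝ (SympSpace V)) :
    Submodule ℝ (SympSpace Iᗮ) :=
  (reduction (horizontal I) L).comap (inclusion Iᗮ)

/-- For `F = I^⊥`, the reduction of `L` modulo `I × {0}` consists of all `(P_F x, y)` with
`(x, y) ∈ L` and `y ∈ F`. -/
theorem mem_horizontalReduction [CompleteSpace V] (I : Submodule ℝ V)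
    (L : Submodule ℝ (SympSpace V)) (w : SympSpace Iᗮ) :
    w ∈ horizontalReduction I L ↔
      ∃ z ∈ L, Iᗮ.starProjection z.fst = (w.fst : V) ∧ z.snd = (w.snd : V) := by
  have hsharp : ∀ z : SympSpace V, z ∈ sharp (horizontal I) ↔ z.snd ∈ Iᗮ := by
    intro z
    rw [Submodule.mem_orthogonal]
    constructor
    · intro h u hu
      have := h (WithLp.toLp 2 (u, 0)) ⟨hu, rfl⟩
      simpa [omega, real_inner_comm] using this
    · rintro h u ⟨hu, hu'⟩
      have := h _ hu
      simpa [omega, hu', real_inner_comm] using this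
  have hproj : ∀ z : SympSpace V, z.snd ∈ Iᗮ →
      (reducedSpace (horizontal I)).starProjection z =
        WithLp.toLp 2 (Iᗮ.starProjection z.fst, z.snd) := by
    intro z hz
    refine Submodule.eq_starProjection_of_mem_of_inner_eq_zero ?_ ?_
    · rw [reducedSpace_horizontal]
      exact ⟨WithLp.toLp 2 (Iᗮ.orthogonalProjectionOnto z.fst, ⟨z.snd, hz⟩), rfl⟩
    · intro w hw
      rw [reducedSpace_horizontal] at hw
      obtain ⟨w, rfl⟩ := hw
      simp [WithLp.prod_inner_apply, inclusion]
  constructor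
  · rintro ⟨z, ⟨hzL, hz⟩, h⟩
    have hz' := (hsharp z).1 hz
    have h' : WithLp.toLp 2 (Iᗮ.starProjection z.fst, z.snd) = inclusion Iᗮ w :=
      (hproj z hz').symm.trans h
    exact ⟨z, hzL, congrArg WithLp.fst h', congrArg WithLp.snd h'⟩
  · rintro ⟨z, hzL, h1, h2⟩
    have hz' : z.snd ∈ Iᗮ := h2 ▸ w.snd.2
    refine ⟨z, ⟨hzL, (hsharp z).2 hz'⟩, ?_⟩
    refine (hproj z hz').trans ?_
    rw [h1, h2]
    rfl

/-- `I` is closed and, for all `t ∈ [a, b]`, `𝓛 t` has a clean intersection with `I × {0}`. -/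
structure IsCleanFor (I : Submodule ℝ V) (𝓛 : ℝ → LagrangianGrassmannian V) (a b : ℝ) :
    Prop where
  isClosed : IsClosed (I : Set V)
  clean : ∀ t ∈ Set.Icc a b, HasCleanIntersection (𝓛 t).space (horizontal I)

/-- On `[a, b]`, the path `l` in `Λ(I^⊥)` is the symplectic reduction modulo `I₀ = I × {0}` of the
path `𝓛` in `Λ(V)`. -/
def IsReducedPath [CompleteSpace V] (I : Submodule ℝ V) (𝓛 : ℝ → LagrangianGrassmannian V) (a b : ℝ)
    (l : ℝ → LagrangianGrassmannian Iᗮ) : Prop :=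
  ∀ t ∈ Set.Icc a b, (l t).space = horizontalReduction I (𝓛 t).space

/-- The orthogonal complement of a subspace of finite codimension is finite-dimensional. -/
instance (I : Submodule ℝ V) [FiniteDimensional ℝ (V ⧸ I)] : FiniteDimensional ℝ Iᗮ := by
  refine FiniteDimensional.of_injective (I.mkQ ∘ₗ Iᗮ.subtype) ?_
  rw [← LinearMap.ker_eq_bot, LinearMap.ker_eq_bot']
  rintro ⟨x, hx⟩ h
  have hxI : x ∈ I := by simpa using h
  have : x ∈ I ⊓ Iᗮ := ⟨hxI, hx⟩
  rw [Submodule.inf_orthogonal_eq_bot] at this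
  simpa using this

end Reduction

/-! ### The Maslov index in finite dimensions -/

section Maslov

variable {V : Type*} [NormedAddCommGroup V] [InnerProductSpace ℝ V]

theorem IsLagrangian.finrank_eq [FiniteDimensional ℝ V] {L : Submodule ℝ (SympSpace V)}
    (h : IsLagrangian L) : Module.finrank ℝ L = Module.finrank ℝ V := by
  have h1 : Module.finrank ℝ (L.map complexJ.toLinearMap) = Module.finrank ℝ L :=
    LinearEquiv.finrank_map_eq complexJ L
  have h2 := Submodule.finrank_add_finrank_orthogonal (L.map complexJ.toLinearMap)
  rw [← sharp_eq_orthogonal, ← show L = sharp L from h, h1] at h2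
  have h3 : Module.finrank ℝ (SympSpace V) = Module.finrank ℝ V + Module.finrank ℝ V := by
    rw [(WithLp.linearEquiv 2 ℝ (V × V)).finrank_eq, Module.finrank_prod]
  omega

/-- Given an orthonormal basis `e` of `V` and an orthonormal basis `f` of the Lagrangian subspace
`L` of `S(V) = V × V ≃ V ⊗ ℂ`, `(u, v) ↦ u + i v`, the matrix in the basis `e` of the unitary
operator that sends `e` to `f`. -/
def frameMatrix {n : ℕ} (e : OrthonormalBasis (Fin n) ℝ V) {L : Submodule ℝ (SympSpace V)}
    (f : OrthonormalBasis (Fin n) ℝ L) : Matrix (Fin n) (Fin n) ℂ :=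
  Matrix.of fun j k =>
    ((inner ℝ (e j) (f k : SympSpace V).fst : ℝ) : ℂ) +
      ((inner ℝ (e j) (f k : SympSpace V).snd : ℝ) : ℂ) * Complex.I

/-- The map `det² : Λ(V) → S¹ ⊆ ℂ`: the square of the determinant of a unitary operator sending
`V₀` to `L`. It does not depend on the choice of orthonormal bases, see `detSq_eq`. -/
def detSq [FiniteDimensional ℝ V] (L : LagrangianGrassmannian V) : ℂ :=
  (frameMatrix (stdOrthonormalBasis ℝ V)
    ((stdOrthonormalBasis ℝ L.space).reindex (finCongr L.2.finrank_eq))).det ^ 2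

theorem detSq_eq [FiniteDimensional ℝ V] (L : LagrangianGrassmannian V) {n : ℕ}
    (e : OrthonormalBasis (Fin n) ℝ V) (f : OrthonormalBasis (Fin n) ℝ L.space) :
    detSq L = (frameMatrix e f).det ^ 2 := by
  obtain rfl : n = Module.finrank ℝ V := by
    simpa using (Module.finrank_eq_card_basis e.toBasis).symm
  have key : ∀ (e e' : OrthonormalBasis (Fin (Module.finrank ℝ V)) ℝ V)
      (f f' : OrthonormalBasis (Fin (Module.finrank ℝ V)) ℝ L.space),
      (frameMatrix e' f').det ^ 2 = (frameMatrix e f).det ^ 2 := by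
    intro e e' f f'
    have h1 : frameMatrix e' f' =
        (e'.toBasis.toMatrix e).map Complex.ofRealHom * frameMatrix e f' := by
      ext i k
      have hx : ∀ x : V, inner ℝ (e' i) x = ∑ j, inner ℝ (e' i) (e j) * inner ℝ (e j) x :=
        fun x => (e.sum_inner_mul_inner (e' i) x).symm
      simp only [frameMatrix, Matrix.of_apply, Matrix.mul_apply, Matrix.map_apply,
        Module.Basis.toMatrix_apply, OrthonormalBasis.coe_toBasis_repr_apply,
        OrthonormalBasis.repr_apply_apply, Complex.ofRealHom_eq_coe]
      rw [hx (f' k : SympSpace V).fst, hx (f' k : SympSpace V).snd]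
      push_cast
      rw [Finset.sum_mul, ← Finset.sum_add_distrib]
      exact Finset.sum_congr rfl fun j _ => by ring
    have h2 : frameMatrix e f' =
        frameMatrix e f * (f.toBasis.toMatrix f').map Complex.ofRealHom := by
      ext i k
      have hx : (f' k : SympSpace V) = ∑ j, inner ℝ (f j) (f' k) • (f j : SympSpace V) := by
        conv_lhs => rw [← f.sum_repr' (f' k)]
        simp
      have hfst : inner ℝ (e i) (f' k : SympSpace V).fst =
          ∑ j, inner ℝ (f j) (f' k) * inner ℝ (e i) (f j : SympSpace V).fst := by
        have := congrArg (fun z => inner ℝ (e i) (WithLp.fstₗ 2 ℝ V V z)) hx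
        simp only [map_sum, map_smul, inner_sum, inner_smul_right] at this
        exact this
      have hsnd : inner ℝ (e i) (f' k : SympSpace V).snd =
          ∑ j, inner ℝ (f j) (f' k) * inner ℝ (e i) (f j : SympSpace V).snd := by
        have := congrArg (fun z => inner ℝ (e i) (WithLp.sndₗ 2 ℝ V V z)) hx
        simp only [map_sum, map_smul, inner_sum, inner_smul_right] at this
        exact this
      simp only [frameMatrix, Matrix.of_apply, Matrix.mul_apply, Matrix.map_apply,
        Module.Basis.toMatrix_apply, OrthonormalBasis.coe_toBasis_repr_apply,
        OrthonormalBasis.repr_apply_apply, Complex.ofRealHom_eq_coe]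
      rw [hfst, hsnd]
      push_cast
      rw [Finset.sum_mul, ← Finset.sum_add_distrib]
      exact Finset.sum_congr rfl fun j _ => by ring
    have hdet : ∀ M : Matrix (Fin (Module.finrank ℝ V)) (Fin (Module.finrank ℝ V)) ℝ,
        M.det = 1 ∨ M.det = -1 → (M.map Complex.ofRealHom).det ^ 2 = 1 := by
      intro M hM
      have : (M.map Complex.ofRealHom).det = ((M.det : ℝ) : ℂ) :=
        (RingHom.map_det Complex.ofRealHom M).symm
      rw [this]
      rcases hM with h | h <;> simp [h]
    rw [h1, h2, Matrix.det_mul, Matrix.det_mul, mul_pow, mul_pow,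
      hdet _ (e'.det_to_matrix_orthonormalBasis_real e),
      hdet _ (f.det_to_matrix_orthonormalBasis_real f'), one_mul, mul_one]
  exact key _ _ _ _

/-- `m` is the winding number of the loop `γ : [a, c] → S¹ ⊆ ℂ`. -/
def IsWindingNumber (γ : ℝ → ℂ) (a c : ℝ) (m : ℤ) : Prop :=
  ∃ θ : ℝ → ℝ, ContinuousOn θ (Set.Icc a c) ∧
    (∀ t ∈ Set.Icc a c, γ t = Complex.exp (θ t * Complex.I)) ∧
    θ c - θ a = 2 * Real.pi * m

/-- The loop `lbar : [a, c] → Λ(V)` is the concatenation of the path `l : [a, b] → Λ(V)` with a path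
from `l b` to `l a` consisting of Lagrangian subspaces transverse to `L`. -/
structure IsClosingLoop [CompleteSpace V] (L : LagrangianGrassmannian V)
    (l : ℝ → LagrangianGrassmannian V) (a b c : ℝ) (lbar : ℝ → LagrangianGrassmannian V) :
    Prop where
  le : b ≤ c
  continuousOn : ContinuousOn lbar (Set.Icc a c)
  eq : ∀ t ∈ Set.Icc a b, lbar t = l t
  transverse : ∀ t ∈ Set.Icc b c, IsTransverse (lbar t).space L.space
  closed : lbar c = l a

/-- `m` is the Maslov index `m_L(l)` of the path `l : [a, b] → Λ(V)` relative to `L`: the winding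
number of `det²` along any loop obtained from `l` by joining its endpoints inside the set of
Lagrangian subspaces transverse to `L`. -/
def IsMaslovIndex [FiniteDimensional ℝ V] [CompleteSpace V] (L : LagrangianGrassmannian V)
    (l : ℝ → LagrangianGrassmannian V) (a b : ℝ) (m : ℤ) : Prop :=
  (∃ c lbar, IsClosingLoop L l a b c lbar) ∧
    ∀ c lbar, IsClosingLoop L l a b c lbar → IsWindingNumber (fun t => detSq (lbar t)) a c m

end Maslov

end

end FredholmMaslov

open FredholmMaslov

/-! Cleanness is a quantitative statement: `L` meets `I × {0}` cleanly exactly when `‖(x, 0) - z‖ ≥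
c ‖x‖` for some `c > 0` and all `x ∈ I`, `z ∈ L` (`hasCleanIntersection_iff`). The bound survives
shrinking `I` and, with `c / 2`, small changes of `L` in the gap metric. At a Fredholm point the
orthogonal complement in `H` of `H₀ ∩ L` works, so compactness of `[a, b]` gives one admissible `I`
for the whole path (`exists_isCleanFor`). The reduction is Lagrangian because the closed subspace `L
+ I₀` equals its double symplectic orthogonal, and `c` controls the norm of lifts of reduced
vectors, which makes reduction locally Lipschitz (`dist_reducePoint_le`).

For independence one passes through `I ⊓ J` and so may assume `I ≤ J`. Then `l_J` is a reduction of
`l_I`, and the question is one about reduction between finite-dimensional spaces. There the key is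
`detSq_mul_conj_det_crossMatrix`: if `L'` is the reduction of `L`, then `det² L · conj (det D) =
det² L' · det D`, where `D` collects the coordinates, along the complementary directions `e k`, of
the projections to `L` of the vectors `(0, e k)`. Cleanness makes the imaginary part of `D` positive
definite (`crossMatrix_mem_imPosDef`). Such matrices form a convex set on which `det` has no zero,
so `det D / conj (det D)` has an angle that is a continuous function of `D`. This angle returns to
its initial value around a loop, hence `det² L` and `det² L'` have the same winding number.

Taking all of `V` as the complementary directions, the same matrix gives `det²` a continuous angle
on the Lagrangians transverse to `V₀`. Hence the closing arc does not influence the winding number,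
and the finite-dimensional index exists (`exists_isMaslovIndex`). -/

namespace FredholmMaslov

open Set Filter Topology

/-! ### Continuous angles on convex sets -/

section Angle

variable {E : Type*} [AddCommGroup E] [Module ℝ E] [TopologicalSpace E] [IsTopologicalAddGroup E]
  [ContinuousSMul ℝ E]

/-- A continuous function with values in the unit circle on a convex set has a continuous angle. -/
theorem exists_continuousOn_angle {X : Set E} (hX : Convex ℝ X) {f : E → ℂ} (hf : ContinuousOn f X)
    (hnorm : ∀ x ∈ X, ‖f x‖ = 1) :
    ∃ Θ : E → ℝ, ContinuousOn Θ X ∧ ∀ x ∈ X, f x = Complex.exp (Θ x * Complex.I) := by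
  classical
  rcases X.eq_empty_or_nonempty with rfl | ⟨x₀, hx₀⟩
  · exact ⟨fun _ => 0, by simp, by simp⟩
  let F : X → Circle := fun x => ⟨f x, by simp [Submonoid.unitSphere, hnorm x x.2]⟩
  have hF : Continuous F :=
    Continuous.subtype_mk (continuousOn_iff_continuous_domRestrict.mp hf) _
  let h : unitInterval × X → X := fun p =>
    ⟨(1 - (p.1 : ℝ)) • x₀ + (p.1 : ℝ) • (p.2 : E),
      hX hx₀ p.2.2 (sub_nonneg.2 p.1.2.2) p.1.2.1 (by ring)⟩
  have hh : Continuous h := Continuous.subtype_mk (by fun_prop) _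
  obtain ⟨r, hr⟩ := Circle.exp_surjective (F ⟨x₀, hx₀⟩)
  let H : C(unitInterval × X, Circle) := ⟨F ∘ h, hF.comp hh⟩
  let g : C(X, ℝ) := ContinuousMap.const _ r
  have H0 : ∀ x, H (0, x) = Circle.exp (g x) := by
    intro x
    change F (h (0, x)) = Circle.exp r
    rw [hr]
    congr 1
    ext
    simp [h]
  -- Contracting `X` to `x₀` is a homotopy from the constant `F x₀` to `F`. The constant lifts to
  -- `r`, and the time-one end of the lifted homotopy is the angle.
  let K := Circle.isCoveringMap_exp.liftHomotopy H g H0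
  have hK : ∀ x : X, Circle.exp (K (1, x)) = F x := by
    intro x
    have := congrFun (Circle.isCoveringMap_exp.liftHomotopy_lifts H g H0) (1, x)
    refine this.trans ?_
    change F (h (1, x)) = F x
    congr 1
    ext
    simp [h]
  refine ⟨fun x => if hx : x ∈ X then K (1, ⟨x, hx⟩) else 0, ?_, ?_⟩
  · rw [continuousOn_iff_continuous_domRestrict]
    have : X.domRestrict (fun x => if hx : x ∈ X then K (1, ⟨x, hx⟩) else 0) =
        fun x => K (1, x) := by
      ext x
      simp
    rw [this]
    fun_prop
  · intro x hx
    have := congrArg (fun z : Circle => (z : ℂ)) (hK ⟨x, hx⟩)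
    simp only [Circle.coe_exp] at this
    simp only [hx, dif_pos]
    exact this.symm

end Angle

/-! ### Clean intersections as lower bounds on angles -/

section Clean

variable {E : Type*} [NormedAddCommGroup E] [InnerProductSpace ℝ E] [CompleteSpace E]

/-- Two closed subspaces have a clean intersection if and only if the angle between them is
bounded below. -/
theorem hasCleanIntersection_iff {X Y : Submodule ℝ E} (hX : IsClosed (X : Set E))
    (hY : IsClosed (Y : Set E)) :
    HasCleanIntersection Y X ↔ ∃ c > 0, ∀ x ∈ X, ∀ y ∈ Y, c * ‖x‖ ≤ ‖x - y‖ := by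
  have := hX.completeSpace_coe
  have := hY.completeSpace_coe
  -- Trivial intersection is injectivity of `(x, y) ↦ x - y`, and closed sum is closedness of its
  -- range. Between Banach spaces the two together amount to a lower bound for the map.
  let T : (X × Y) →L[ℝ] E :=
    X.subtypeL.comp (ContinuousLinearMap.fst ℝ X Y) -
      Y.subtypeL.comp (ContinuousLinearMap.snd ℝ X Y)
  have hT : ∀ p, T p = (p.1 : E) - p.2 := fun p => rfl
  have hrange : Set.range T = ((Y ⊔ X : Submodule ℝ E) : Set E) := by
    ext z
    constructor
    · rintro ⟨p, rfl⟩
      exact Submodule.sub_mem _ (Submodule.mem_sup_right p.1.2) (Submodule.mem_sup_left p.2.2)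
    · intro hz
      obtain ⟨y, hy, x, hx, rfl⟩ := Submodule.mem_sup.1 hz
      exact ⟨(⟨x, hx⟩, ⟨-y, Y.neg_mem hy⟩), by simp [hT, add_comm]⟩
  constructor
  · rintro ⟨hbot, hcl⟩
    have hinj : Function.Injective T := by
      rw [injective_iff_map_eq_zero]
      rintro ⟨x, y⟩ h
      have hxy : (x : E) = y := sub_eq_zero.1 h
      have : (x : E) ∈ Y ⊓ X := ⟨hxy ▸ y.2, x.2⟩
      rw [hbot, Submodule.mem_bot] at this
      ext
      · exact this
      · exact hxy ▸ this
    obtain ⟨K, hK⟩ := T.antilipschitz_of_injective_of_isClosed_range hinj (hrange ▸ hcl)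
    refine ⟨((K : ℝ) + 1)⁻¹, by positivity, fun x hx y hy => ?_⟩
    have h1 := hK.le_mul_norm_sub (x := (⟨x, hx⟩, ⟨y, hy⟩)) (y := 0)
    have h2 : ‖x‖ ≤ K * ‖x - y‖ := by
      refine le_trans ?_ (h1.trans (le_of_eq (by simp [hT, norm_sub_rev y x])))
      simp [Prod.norm_def]
    rw [inv_mul_le_iff₀ (by positivity)]
    nlinarith [norm_nonneg (x - y)]
  · rintro ⟨c, hc, h⟩
    constructor
    · rw [eq_bot_iff]
      rintro x ⟨hy, hx⟩
      have := h x hx x hy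
      rw [sub_self, norm_zero] at this
      exact norm_le_zero_iff.1 (nonpos_of_mul_nonpos_right this hc)
    · rw [← hrange]
      have hanti : AntilipschitzWith (Real.toNNReal (c⁻¹ + 1)) T := by
        refine T.antilipschitz_of_bound fun p => ?_
        rw [Real.coe_toNNReal _ (by positivity), hT]
        have h1 : ‖(p.1 : E)‖ ≤ c⁻¹ * ‖(p.1 : E) - p.2‖ := by
          rw [le_inv_mul_iff₀ hc]
          exact h _ p.1.2 _ p.2.2
        have h2 : ‖(p.2 : E)‖ ≤ ‖(p.1 : E)‖ + ‖(p.1 : E) - p.2‖ := by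
          simpa using norm_sub_le (p.1 : E) ((p.1 : E) - p.2)
        rw [Prod.norm_def]
        refine max_le ?_ ?_
        · refine h1.trans ?_
          nlinarith [norm_nonneg ((p.1 : E) - p.2)]
        · refine h2.trans ?_
          linarith
      exact hanti.isClosed_range T.uniformContinuous

/-- If `X + Y` is closed, then the angle between `Y` and the orthogonal complement of `X ∩ Y` in
`X` is bounded below. -/
theorem exists_le_norm_sub_of_isClosed_sup {X Y : Submodule ℝ E} (hX : IsClosed (X : Set E))
    (hY : IsClosed (Y : Set E)) (hXY : IsClosed ((X ⊔ Y : Submodule ℝ E) : Set E)) :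
    ∃ c > 0, ∀ x ∈ X ⊓ (X ⊓ Y)ᗮ, ∀ y ∈ Y, c * ‖x‖ ≤ ‖x - y‖ := by
  refine (hasCleanIntersection_iff (hX.inter (Submodule.isClosed_orthogonal _)) hY).1 ⟨?_, ?_⟩
  · rw [eq_bot_iff]
    rintro x ⟨hy, hx, hx'⟩
    have : x ∈ (X ⊓ Y) ⊓ (X ⊓ Y)ᗮ := ⟨⟨hx, hy⟩, hx'⟩
    rwa [Submodule.inf_orthogonal_eq_bot] at this
  · have hc : IsClosed ((X ⊓ Y : Submodule ℝ E) : Set E) := hX.inter hY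
    have := hc.completeSpace_coe
    convert hXY using 2
    apply le_antisymm
    · exact sup_le le_sup_right (inf_le_left.trans le_sup_left)
    · refine sup_le (fun x hx => ?_) le_sup_left
      have h1 := (X ⊓ Y).starProjection_apply_mem x
      rw [← add_sub_cancel ((X ⊓ Y).starProjection x) x]
      refine Submodule.add_mem_sup h1.2 ⟨X.sub_mem hx h1.1, ?_⟩
      exact Submodule.sub_starProjection_mem_orthogonal x

end Clean

/-! ### The gap metric in terms of the symplectic form -/

section Gap

variable {V : Type*} [NormedAddCommGroup V] [InnerProductSpace ℝ V]

theorem inner_complexJ_complexJ (z w : SympSpace V) :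
    inner ℝ (complexJ z) (complexJ w) = inner ℝ z w := by
  simp [complexJ, WithLp.prod_inner_apply, add_comm]

theorem norm_complexJ (z : SympSpace V) : ‖complexJ z‖ = ‖z‖ := by
  rw [← sq_eq_sq₀ (norm_nonneg _) (norm_nonneg _), ← real_inner_self_eq_norm_sq,
    ← real_inner_self_eq_norm_sq, inner_complexJ_complexJ]

theorem omega_swap (z w : SympSpace V) : omega z w = -omega w z := by
  simp [omega]

theorem omega_sub_right (z u w : SympSpace V) : omega z (u - w) = omega z u - omega z w := by
  simp only [omega_eq_inner, inner_sub_right]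

theorem omega_sub_left (z u w : SympSpace V) : omega (u - w) z = omega u z - omega w z := by
  rw [omega_swap, omega_sub_right, omega_swap u, omega_swap w]; ring

theorem abs_omega_le (z w : SympSpace V) : |omega z w| ≤ ‖z‖ * ‖w‖ := by
  rw [omega_eq_inner, ← norm_complexJ z]
  exact abs_real_inner_le_norm _ _

/-- For a closed subspace `W` one has `W^♯^♯ = W`. -/
theorem sharp_sharp [CompleteSpace V] {W : Submodule ℝ (SympSpace V)}
    (hW : IsClosed (W : Set (SympSpace V))) : sharp (sharp W) = W := by
  have := hW.completeSpace_coe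
  apply le_antisymm
  · intro v hv
    rw [← Submodule.orthogonal_orthogonal W, Submodule.mem_orthogonal]
    intro u hu
    have hu' : -complexJ u ∈ sharp W := by
      intro x hx
      rw [omega_eq_inner, inner_neg_right, inner_complexJ_complexJ, neg_eq_zero]
      exact (Submodule.mem_orthogonal _ _).1 hu x hx
    have := hv _ hu'
    rw [omega_eq_inner] at this
    convert this using 2
    apply WithLp.ofLp_injective
    ext <;> simp [complexJ]
  · intro v hv u hu
    rw [omega_swap, hu v hv, neg_zero]

namespace LagrangianGrassmannian

variable (L M : LagrangianGrassmannian V)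

theorem mem_space_iff {z : SympSpace V} : z ∈ L.space ↔ ∀ u ∈ L.space, omega u z = 0 := by
  conv_lhs => rw [show L.space = sharp L.space from L.2]
  rfl

theorem omega_eq_zero {z w : SympSpace V} (hz : z ∈ L.space) (hw : w ∈ L.space) :
    omega z w = 0 :=
  (L.mem_space_iff.1 hw) z hz

/-- For a Lagrangian `L` one has `L^⊥ = J L`. This turns inner products with vectors of `L^⊥` into
values of `omega` on `L`. -/
theorem exists_complexJ_eq {z : SympSpace V} (hz : z ∈ L.spaceᗮ) :
    ∃ w ∈ L.space, complexJ w = z := by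
  refine ⟨complexJ.symm z, ?_, by simp⟩
  rw [mem_space_iff]
  intro u hu
  rw [omega_swap, omega_eq_inner, LinearEquiv.apply_symm_apply, neg_eq_zero, real_inner_comm]
  exact (Submodule.mem_orthogonal _ _).1 hz u hu

variable [CompleteSpace V]

theorem projector_apply_mem (z : SympSpace V) : L.projector z ∈ L.space :=
  L.space.starProjection_apply_mem z

theorem norm_sub_projector_le {z w : SympSpace V} (hw : w ∈ L.space) :
    ‖z - L.projector z‖ ≤ ‖z - w‖ := by
  have h1 := Submodule.starProjection_minimal (U := L.space) z
  rw [projector, h1]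
  exact ciInf_le ⟨0, by rintro _ ⟨x, rfl⟩; exact norm_nonneg _⟩ (⟨w, hw⟩ : L.space)

theorem projector_eq_self {z : SympSpace V} (hz : z ∈ L.space) : L.projector z = z :=
  Submodule.starProjection_eq_self_iff.2 hz

theorem norm_projector_sub_le (z : SympSpace V) :
    ‖L.projector z - M.projector z‖ ≤ dist L M * ‖z‖ := by
  rw [dist_eq]
  exact (L.projector - M.projector).le_opNorm z

variable {L M}

/-- The gap between two Lagrangian subspaces is controlled by the values of the symplectic form on
their product. -/
theorem dist_le_of_omega {K : ℝ} (hK : 0 ≤ K)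
    (h : ∀ u ∈ L.space, ∀ w ∈ M.space, |omega u w| ≤ K * ‖u‖ * ‖w‖) : dist L M ≤ 2 * K := by
  rw [dist_eq]
  refine ContinuousLinearMap.opNorm_le_bound _ (by positivity) fun x => ?_
  have key : ∀ u ≠ (0 : SympSpace V), ∀ C, ‖u‖ ^ 2 ≤ C * ‖u‖ → ‖u‖ ≤ C := by
    intro u hu C hC
    have : 0 < ‖u‖ := norm_pos_iff.2 hu
    nlinarith
  -- With `x = p + q`, `p ∈ M` and `q ∈ M^⊥ = J M`, the difference `(P_L - P_M) x` is `P_L q - (p -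
  -- P_L p)`. The squared norm of each term is, up to sign, a value of `omega` on `L × M`, so each
  -- costs `K ‖x‖`.
  set p := M.projector x with hp
  set q := x - p with hq
  have hpn : ‖p‖ ≤ ‖x‖ := M.space.norm_starProjection_apply_le x
  have hqn : ‖q‖ ≤ ‖x‖ := by simpa using M.norm_sub_projector_le (z := x) (Submodule.zero_mem _)
  have hqM : q ∈ M.spaceᗮ := Submodule.sub_starProjection_mem_orthogonal x
  have h1 : ‖L.projector q‖ ≤ K * ‖x‖ := by
    by_cases h0 : L.projector q = 0
    · rw [h0, norm_zero]; positivity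
    refine key _ h0 _ ?_
    obtain ⟨m, hm, hmq⟩ := M.exists_complexJ_eq hqM
    have hmn : ‖m‖ ≤ ‖x‖ := by rw [← norm_complexJ, hmq]; exact hqn
    have e1 : ‖L.projector q‖ ^ 2 = inner ℝ q (L.projector q) := by
      rw [← real_inner_self_eq_norm_sq]
      have := Submodule.starProjection_inner_eq_zero (K := L.space) q _ (L.projector_apply_mem q)
      rw [inner_sub_left, sub_eq_zero] at this
      exact this.symm
    rw [e1, ← hmq, ← omega_eq_inner, omega_swap]
    refine (neg_le_abs _).trans ((h _ (L.projector_apply_mem _) _ hm).trans ?_)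
    have := norm_nonneg (L.projector (complexJ m))
    calc _ = K * ‖m‖ * ‖L.projector (complexJ m)‖ := by ring
      _ ≤ _ := by gcongr
  have h2 : ‖p - L.projector p‖ ≤ K * ‖x‖ := by
    by_cases h0 : p - L.projector p = 0
    · rw [h0, norm_zero]; positivity
    refine key _ h0 _ ?_
    have hpL : p - L.projector p ∈ L.spaceᗮ := Submodule.sub_starProjection_mem_orthogonal p
    obtain ⟨m, hm, hmq⟩ := L.exists_complexJ_eq hpL
    have hmn : ‖m‖ = ‖p - L.projector p‖ := by rw [← norm_complexJ, hmq]
    have e1 : ‖p - L.projector p‖ ^ 2 = inner ℝ (p - L.projector p) p := by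
      rw [← real_inner_self_eq_norm_sq]
      have := Submodule.starProjection_inner_eq_zero (K := L.space) p _ (L.projector_apply_mem p)
      rw [inner_sub_right, show inner ℝ (p - L.projector p) (L.projector p) = 0 from this, sub_zero]
    rw [e1, ← hmn]
    nth_rw 1 [← hmq]
    rw [← omega_eq_inner]
    refine (le_abs_self _).trans ((h _ hm _ (M.projector_apply_mem x)).trans ?_)
    rw [← hp]
    calc _ = K * ‖p‖ * ‖m‖ := by ring
      _ ≤ _ := by gcongr
  have h3 : (L.projector - M.projector) x = L.projector q - (p - L.projector p) := by
    rw [hq, map_sub]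
    simp only [sub_apply, ← hp]
    abel
  rw [h3]
  refine (norm_sub_le _ _).trans ?_
  linarith

end LagrangianGrassmannian

end Gap

end FredholmMaslov

namespace FredholmMaslov

open Set Filter Topology

/-! ### Horizontal and vertical vectors -/

section Vectors

theorem sympSpace_ext {V : Type*} {z w : WithLp 2 (V × V)} (h₁ : z.fst = w.fst)
    (h₂ : z.snd = w.snd) : z = w :=
  WithLp.ofLp_injective _ (Prod.ext h₁ h₂)

variable {V : Type*} [NormedAddCommGroup V]

/-- The horizontal vector `(x, 0)`. -/
def horizontalVector (x : V) : WithLp 2 (V × V) := WithLp.toLp 2 (x, 0)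

/-- The vertical vector `(0, y)`. -/
def verticalVector (y : V) : WithLp 2 (V × V) := WithLp.toLp 2 (0, y)

theorem norm_horizontalVector (x : V) : ‖horizontalVector x‖ = ‖x‖ := by
  rw [← sq_eq_sq₀ (norm_nonneg _) (norm_nonneg _), WithLp.prod_norm_sq_eq_of_L2]
  simp [horizontalVector]

end Vectors

/-! ### Reduction along isometric embeddings, and its continuity -/

section ReductionAlong

variable {U G V : Type*} [NormedAddCommGroup U] [InnerProductSpace ℝ U] [NormedAddCommGroup G]
  [InnerProductSpace ℝ G] [NormedAddCommGroup V] [InnerProductSpace ℝ V]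

/-- The isometric embedding `S(G) → S(V)` induced by an isometric embedding `G → V`. -/
def sympMap (φ : G →ₗᵢ[ℝ] V) (w : SympSpace G) : SympSpace V := WithLp.toLp 2 (φ w.fst, φ w.snd)

theorem norm_sympMap (φ : G →ₗᵢ[ℝ] V) (w : SympSpace G) : ‖sympMap φ w‖ = ‖w‖ := by
  rw [← sq_eq_sq₀ (norm_nonneg _) (norm_nonneg _), WithLp.prod_norm_sq_eq_of_L2,
    WithLp.prod_norm_sq_eq_of_L2]
  simp [sympMap]

/-- The symplectic reduction of `L ⊆ S(V)` along an isometric embedding `φ : G → V`: all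
`(φ* x, y)` with `(x, φ y) ∈ L`. -/
def reduce (φ : G →ₗᵢ[ℝ] V) (L : Submodule ℝ (SympSpace V)) : Submodule ℝ (SympSpace G) where
  carrier := {w | ∃ z ∈ L, (∀ g, inner ℝ (φ g) z.fst = inner ℝ g w.fst) ∧ z.snd = φ w.snd}
  zero_mem' := ⟨0, L.zero_mem, by simp, by simp⟩
  add_mem' := by
    rintro w w' ⟨z, hz, h1, h2⟩ ⟨z', hz', h1', h2'⟩
    exact ⟨z + z', L.add_mem hz hz', fun g => by simp [inner_add_right, h1, h1'],
      by simp [h2, h2']⟩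
  smul_mem' := by
    rintro c w ⟨z, hz, h1, h2⟩
    exact ⟨c • z, L.smul_mem c hz, fun g => by simp [inner_smul_right, h1], by simp [h2]⟩

theorem mem_reduce {φ : G →ₗᵢ[ℝ] V} {L : Submodule ℝ (SympSpace V)} {w : SympSpace G} :
    w ∈ reduce φ L ↔
      ∃ z ∈ L, (∀ g, inner ℝ (φ g) z.fst = inner ℝ g w.fst) ∧ z.snd = φ w.snd :=
  Iff.rfl

theorem exists_forall_inner_eq [CompleteSpace G] [CompleteSpace V] (φ : G →ₗᵢ[ℝ] V) (x : V) :
    ∃ u : G, ∀ g, inner ℝ (φ g) x = inner ℝ g u :=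
  ⟨(ContinuousLinearMap.adjoint φ.toContinuousLinearMap) x, fun g => by
    rw [ContinuousLinearMap.adjoint_inner_right]; rfl⟩

/-- Transitivity is what allows different admissible subspaces to be compared. The intermediate
vector is `(φ* x, ψ y)`, with `φ*` the adjoint. -/
theorem reduce_reduce [CompleteSpace G] [CompleteSpace V] (φ : G →ₗᵢ[ℝ] V) (ψ : U →ₗᵢ[ℝ] G)
    (L : Submodule ℝ (SympSpace V)) : reduce ψ (reduce φ L) = reduce (φ.comp ψ) L := by
  ext w
  constructor
  · rintro ⟨v, ⟨z, hz, h1, h2⟩, h3, h4⟩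
    exact ⟨z, hz, fun g => by simp [h1, h3], by simp [h2, h4]⟩
  · rintro ⟨z, hz, h1, h2⟩
    obtain ⟨u, hu⟩ := exists_forall_inner_eq φ z.fst
    exact ⟨WithLp.toLp 2 (u, ψ w.snd), ⟨z, hz, hu, h2⟩,
      fun g => ((hu (ψ g)).symm.trans (h1 g)), rfl⟩

/-- The horizontal vectors `(x, 0)` with `x` orthogonal to the range of `φ` make with `L` an angle
that is bounded below by `c`. -/
def CleanWith (φ : G →ₗᵢ[ℝ] V) (c : ℝ) (L : Submodule ℝ (SympSpace V)) : Prop :=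
  ∀ x, (∀ g, inner ℝ (φ g) x = 0) → ∀ z ∈ L, c * ‖x‖ ≤ ‖horizontalVector x - z‖

/-- `L` has a clean intersection with `I × {0}`, where `I` is the orthogonal complement of the
range of `φ`. -/
def CleanAlong (φ : G →ₗᵢ[ℝ] V) (L : Submodule ℝ (SympSpace V)) : Prop :=
  ∃ c > 0, CleanWith φ c L

theorem isClosed_horizontal {I : Submodule ℝ V} (hI : IsClosed (I : Set V)) :
    IsClosed (horizontal I : Set (SympSpace V)) := by
  have h1 : IsClosed {z : SympSpace V | z.fst ∈ I} :=
    hI.preimage (WithLp.prod_continuous_ofLp 2 V V).fst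
  have h2 : IsClosed {z : SympSpace V | z.snd = 0} :=
    isClosed_singleton.preimage (WithLp.prod_continuous_ofLp 2 V V).snd
  exact h1.inter h2

theorem hasCleanIntersection_horizontal_iff [CompleteSpace V] {I : Submodule ℝ V}
    (hI : IsClosed (I : Set V)) (L : LagrangianGrassmannian V) :
    HasCleanIntersection L.space (horizontal I) ↔
      ∃ c > 0, ∀ x ∈ I, ∀ z ∈ L.space, c * ‖x‖ ≤ ‖horizontalVector x - z‖ := by
  rw [hasCleanIntersection_iff (isClosed_horizontal hI) L.isClosed_space]
  refine exists_congr fun c => and_congr_right fun _ =>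
    ⟨fun h x hx z hz => ?_, fun h x hx z hz => ?_⟩
  · rw [← norm_horizontalVector x]
    exact h (horizontalVector x) ⟨hx, rfl⟩ z hz
  · obtain ⟨y, rfl⟩ : ∃ y, horizontalVector y = x := ⟨x.fst, sympSpace_ext rfl hx.2.symm⟩
    rw [norm_horizontalVector]
    exact h y hx.1 z hz

theorem mem_orthogonal_range_iff {φ : G →ₗᵢ[ℝ] V} {x : V} :
    x ∈ (LinearMap.range φ.toLinearMap)ᗮ ↔ ∀ g, inner ℝ (φ g) x = 0 := by
  rw [Submodule.mem_orthogonal]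
  exact ⟨fun h g => h _ ⟨g, rfl⟩, by rintro h _ ⟨g, rfl⟩; exact h g⟩

theorem cleanAlong_iff [CompleteSpace V] (φ : G →ₗᵢ[ℝ] V) (L : LagrangianGrassmannian V) :
    CleanAlong φ L.space ↔
      HasCleanIntersection L.space (horizontal (LinearMap.range φ.toLinearMap)ᗮ) := by
  rw [hasCleanIntersection_horizontal_iff (Submodule.isClosed_orthogonal _)]
  simp only [mem_orthogonal_range_iff]
  rfl

/-- The reduction of a Lagrangian subspace along a clean intersection is Lagrangian. -/
theorem isLagrangian_reduce [CompleteSpace G] [CompleteSpace V] {φ : G →ₗᵢ[ℝ] V}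
    {L : LagrangianGrassmannian V} (h : CleanAlong φ L.space) :
    IsLagrangian (reduce φ L.space) := by
  have hclosed := ((cleanAlong_iff φ L).1 h).2
  set I := (LinearMap.range φ.toLinearMap)ᗮ with hI
  apply le_antisymm
  · rintro w ⟨z, hz, h1, h2⟩ u ⟨y, hy, h3, h4⟩
    have := L.omega_eq_zero hy hz
    rwa [omega, h2, h4, h1, h3] at this
  · intro w hw
    -- By closedness `L + I₀` is its own double `♯`. A vector `u` of `(L + I₀)^♯` lies in `L` and
    -- has second component in `I^⊥ = range φ`, so it reduces to a vector that pairs to zero with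
    -- `w`.
    have hmem : sympMap φ w ∈ L.space ⊔ horizontal I := by
      rw [← sharp_sharp hclosed]
      intro u hu
      have huL : u ∈ L.space := by
        rw [L.mem_space_iff]
        exact fun v hv => hu v (Submodule.mem_sup_left hv)
      have huI : u.snd ∈ Iᗮ := by
        rw [Submodule.mem_orthogonal]
        intro x hx
        have := hu (horizontalVector x) (Submodule.mem_sup_right ⟨hx, rfl⟩)
        simpa [omega, horizontalVector, real_inner_comm] using this
      have hc : IsClosed ((LinearMap.range φ.toLinearMap : Submodule ℝ V) : Set V) := by
        rw [LinearMap.coe_range]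
        exact φ.isometry.isClosedEmbedding.isClosed_range
      have := hc.completeSpace_coe
      rw [hI, Submodule.orthogonal_orthogonal] at huI
      obtain ⟨y, hy⟩ := huI
      obtain ⟨v, hv⟩ := exists_forall_inner_eq φ u.fst
      have := hw (WithLp.toLp 2 (v, y)) ⟨u, huL, hv, hy.symm⟩
      have hy' : u.snd = φ y := hy.symm
      have e1 : inner ℝ (φ y) (φ w.fst) = inner ℝ y w.fst := φ.inner_map_map _ _
      change inner ℝ (φ w.snd) u.fst - inner ℝ u.snd (φ w.fst) = 0
      rw [hy', e1, hv]
      exact this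
    obtain ⟨z, hz, i, ⟨hi, hi'⟩, hzi⟩ := Submodule.mem_sup.1 hmem
    refine ⟨z, hz, fun g => ?_, ?_⟩
    · have h1 := congrArg WithLp.fst hzi
      have h2 : z.fst + i.fst = φ w.fst := h1
      have h3 := mem_orthogonal_range_iff.1 hi g
      rw [← φ.inner_map_map, ← h2, inner_add_right, h3, add_zero]
    · have h1 := congrArg WithLp.snd hzi
      have h2 : z.snd + i.snd = φ w.snd := h1
      rwa [hi', add_zero] at h2

theorem exists_horizontalVector_eq {φ : G →ₗᵢ[ℝ] V} {z : SympSpace V} {w : SympSpace G}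
    (h₁ : ∀ g, inner ℝ (φ g) z.fst = inner ℝ g w.fst) (h₂ : z.snd = φ w.snd) :
    ∃ x, (∀ g, inner ℝ (φ g) x = 0) ∧ z = sympMap φ w + horizontalVector x := by
  refine ⟨z.fst - φ w.fst, fun g => ?_, sympSpace_ext ?_ ?_⟩
  · rw [inner_sub_right, h₁, φ.inner_map_map, sub_self]
  · simp [sympMap, horizontalVector]
  · simp [sympMap, horizontalVector, h₂]

/-- A lift `z` of `w` is `sympMap φ w + (x, 0)` with `x` orthogonal to `range φ`. Its distance to
`(x, 0)` is `‖w‖`, so cleanness bounds `‖x‖` by `c⁻¹ ‖w‖`. -/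
theorem CleanWith.norm_le {φ : G →ₗᵢ[ℝ] V} {L : Submodule ℝ (SympSpace V)} {c : ℝ} (hc : 0 < c)
    (h : CleanWith φ c L) {z : SympSpace V} {w : SympSpace G} (hz : z ∈ L)
    (h₁ : ∀ g, inner ℝ (φ g) z.fst = inner ℝ g w.fst) (h₂ : z.snd = φ w.snd) :
    ‖z‖ ≤ (1 + c⁻¹) * ‖w‖ := by
  obtain ⟨x, hx, rfl⟩ := exists_horizontalVector_eq h₁ h₂
  have h3 := h x hx _ hz
  rw [sub_add_cancel_right, norm_neg, norm_sympMap, ← le_inv_mul_iff₀ hc] at h3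
  refine (norm_add_le _ _).trans ?_
  rw [norm_sympMap, norm_horizontalVector]
  linarith

/-- If `z` lifts `w` with horizontal defect `y`, then `(φ x + y, 0) - z` is the isometric image of
`(x, 0) - w`. Since `y` is orthogonal to `φ x`, passing from `x` to `φ x + y` does not decrease the
norm, and `c` is preserved. -/
theorem CleanWith.reduce {φ : G →ₗᵢ[ℝ] V} {ψ : U →ₗᵢ[ℝ] G} {L : Submodule ℝ (SympSpace V)} {c : ℝ}
    (hc : 0 < c) (h : CleanWith (φ.comp ψ) c L) : CleanWith ψ c (reduce φ L) := by
  rintro x hx w ⟨z, hz, h1, h2⟩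
  obtain ⟨y, hy, rfl⟩ := exists_horizontalVector_eq h1 h2
  have h3 := h (φ x + y) (fun g => by
    rw [inner_add_right]
    simp [hy, hx]) _ hz
  have h4 : horizontalVector (φ x + y) - (sympMap φ w + horizontalVector y) =
      sympMap φ (horizontalVector x - w) := by
    apply sympSpace_ext <;> simp [horizontalVector, sympMap]
  rw [h4, norm_sympMap] at h3
  refine le_trans ?_ h3
  have h5 : ‖x‖ ≤ ‖φ x + y‖ := by
    rw [← sq_le_sq₀ (norm_nonneg _) (norm_nonneg _), @norm_add_sq_real, hy, φ.norm_map]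
    nlinarith [sq_nonneg ‖y‖]
  gcongr

/-- This makes reduction available on the transverse arc that closes a path. -/
theorem IsTransverse.cleanAlong [CompleteSpace V] {L : LagrangianGrassmannian V}
    (h : IsTransverse L.space (horizontalFrame V)) (φ : G →ₗᵢ[ℝ] V) : CleanAlong φ L.space := by
  have h1 : HasCleanIntersection L.space (horizontalFrame V) :=
    ⟨h.inf_eq_bot, by rw [h.sup_eq_top]; exact isClosed_univ⟩
  obtain ⟨c, hc, h2⟩ := (hasCleanIntersection_horizontal_iff isClosed_univ L).1 h1
  exact ⟨c, hc, fun x _ => h2 x trivial⟩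

theorem IsTransverse.reduce [CompleteSpace G] [CompleteSpace V] {L : Submodule ℝ (SympSpace V)}
    (h : IsTransverse L (horizontalFrame V)) (φ : G →ₗᵢ[ℝ] V) :
    IsTransverse (reduce φ L) (horizontalFrame G) := by
  refine IsCompl.of_eq ?_ ?_
  · rw [eq_bot_iff]
    rintro w ⟨⟨z, hz, h1, h2⟩, -, hw⟩
    have hz0 : z ∈ L ⊓ horizontalFrame V := ⟨hz, trivial, by rw [h2, hw, map_zero]⟩
    rw [h.inf_eq_bot, Submodule.mem_bot] at hz0
    subst hz0
    refine sympSpace_ext ?_ hw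
    have := h1 w.fst
    simpa using this.symm
  · rw [eq_top_iff]
    intro w _
    have hm : verticalVector (φ w.snd) ∈ L ⊔ horizontalFrame V := by rw [h.sup_eq_top]; trivial
    obtain ⟨z, hz, i, ⟨-, hi⟩, hzi⟩ := Submodule.mem_sup.1 hm
    obtain ⟨u, hu⟩ := exists_forall_inner_eq φ z.fst
    have h2 : z.snd + i.snd = φ w.snd := congrArg WithLp.snd hzi
    rw [hi, add_zero] at h2
    have h3 : w = WithLp.toLp 2 (u, w.snd) + horizontalVector (w.fst - u) := by
      apply sympSpace_ext <;> simp [horizontalVector]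
    rw [h3]
    exact Submodule.add_mem_sup ⟨z, hz, hu, h2⟩ ⟨trivial, rfl⟩

theorem CleanWith.of_dist_le [CompleteSpace V] {φ : G →ₗᵢ[ℝ] V}
    {L M : LagrangianGrassmannian V} {c : ℝ} (h : CleanWith φ c L.space) (hd : dist L M ≤ c / 2) :
    CleanWith φ (c / 2) M.space := by
  intro x hx z hz
  set y := horizontalVector x with hy
  have h1 := h x hx _ (L.projector_apply_mem y)
  have h2 := M.norm_sub_projector_le (z := y) hz
  have h3 := L.norm_projector_sub_le M y
  have h4 : ‖y - L.projector y‖ ≤ ‖y - M.projector y‖ + ‖L.projector y - M.projector y‖ := by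
    rw [norm_sub_rev (L.projector y)]
    exact norm_sub_le_norm_sub_add_norm_sub _ _ _
  rw [← hy] at h1
  rw [hy, norm_horizontalVector, ← hy] at h3
  nlinarith [norm_nonneg x]

/-- The adjoint of the inclusion of `I^⊥` is the orthogonal projection, so the reduction used in the
theorem is an instance of `reduce`. -/
theorem horizontalReduction_eq_reduce [CompleteSpace V] (I : Submodule ℝ V)
    (L : Submodule ℝ (SympSpace V)) :
    horizontalReduction I L = reduce Iᗮ.subtypeₗᵢ L := by
  ext w
  rw [mem_horizontalReduction, mem_reduce]
  refine exists_congr fun z => and_congr_right fun _ => and_congr_left fun _ => ?_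
  constructor
  · intro h g
    rw [Submodule.coe_inner, ← h, ← Submodule.inner_starProjection_left_eq_right,
      Submodule.starProjection_eq_self_iff.2 g.2]
    rfl
  · intro h
    refine Submodule.eq_starProjection_of_mem_of_inner_eq_zero w.fst.2 fun g hg => ?_
    rw [inner_sub_left, sub_eq_zero, real_inner_comm, real_inner_comm g]
    exact h ⟨g, hg⟩

open scoped Classical in
/-- The symplectic reduction along `φ` as a map of Lagrangian Grassmannians; outside of the set of
Lagrangian subspaces with a Lagrangian reduction it takes the value `G × {0}`. -/
noncomputable def reducePoint (φ : G →ₗᵢ[ℝ] V) (L : LagrangianGrassmannian V) :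
    LagrangianGrassmannian G :=
  if h : IsLagrangian (reduce φ L.space) then ⟨reduce φ L.space, h⟩ else frameLagrangian G

variable [CompleteSpace G] [CompleteSpace V]

theorem space_reducePoint {φ : G →ₗᵢ[ℝ] V} {L : LagrangianGrassmannian V}
    (h : CleanAlong φ L.space) : (reducePoint φ L).space = reduce φ L.space := by
  have : reducePoint φ L = ⟨reduce φ L.space, isLagrangian_reduce h⟩ :=
    dif_pos (isLagrangian_reduce h)
  rw [this]
  rfl

/-- The symplectic form of two reduced vectors equals that of their lifts `y ∈ L` and `z ∈ M`.
Subtracting `P_L z`, which pairs to zero with `y`, leaves a vector of norm at most `dist L M * ‖z‖`.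
Each lift contributes a factor `1 + c⁻¹`. -/
theorem dist_reducePoint_le {φ : G →ₗᵢ[ℝ] V} {L M : LagrangianGrassmannian V} {c : ℝ} (hc : 0 < c)
    (hL : CleanWith φ c L.space) (hM : CleanWith φ c M.space) :
    dist (reducePoint φ L) (reducePoint φ M) ≤ 2 * ((1 + c⁻¹) ^ 2 * dist L M) := by
  refine LagrangianGrassmannian.dist_le_of_omega (by positivity) ?_
  rw [space_reducePoint ⟨c, hc, hL⟩, space_reducePoint ⟨c, hc, hM⟩]
  rintro u ⟨y, hy, h1, h2⟩ w ⟨z, hz, h3, h4⟩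
  have e : omega u w = omega y (z - L.projector z) := by
    rw [omega_sub_right, L.omega_eq_zero hy (L.projector_apply_mem z), sub_zero]
    rw [omega, omega, h2, h4, h1, h3]
  have hz' : ‖z - L.projector z‖ ≤ dist L M * ‖z‖ := by
    have := L.norm_projector_sub_le M z
    rwa [M.projector_eq_self hz, norm_sub_rev] at this
  have hy1 := hL.norm_le hc hy h1 h2
  have hz1 := hM.norm_le hc hz h3 h4
  rw [e]
  calc |omega y (z - L.projector z)| ≤ ‖y‖ * ‖z - L.projector z‖ := abs_omega_le _ _
    _ ≤ ((1 + c⁻¹) * ‖u‖) * (dist L M * ((1 + c⁻¹) * ‖w‖)) := by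
      gcongr
      exact hz'.trans (by gcongr)
    _ = _ := by ring

theorem continuousOn_reducePoint (φ : G →ₗᵢ[ℝ] V) :
    ContinuousOn (reducePoint φ) {L | CleanAlong φ L.space} := by
  rintro L ⟨c, hc, hL⟩
  refine ContinuousAt.continuousWithinAt ?_
  rw [ContinuousAt, tendsto_iff_dist_tendsto_zero]
  have hL' : CleanWith φ (c / 2) L.space := hL.of_dist_le (by rw [dist_self]; positivity)
  refine squeeze_zero' (g := fun M => 2 * ((1 + (c / 2)⁻¹) ^ 2 * dist M L))
    (Eventually.of_forall fun _ => dist_nonneg) ?_ ?_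
  · filter_upwards [Metric.ball_mem_nhds L (half_pos hc)] with M hM
    exact dist_reducePoint_le (half_pos hc)
      (hL.of_dist_le (by rw [dist_comm]; exact (Metric.mem_ball.1 hM).le)) hL'
  · have : Continuous fun M : LagrangianGrassmannian V =>
        2 * ((1 + (c / 2)⁻¹) ^ 2 * dist M L) := by fun_prop
    simpa using this.tendsto L

end ReductionAlong

end FredholmMaslov

namespace FredholmMaslov

open Set Filter Topology Matrix

open scoped ComplexConjugate ComplexOrder

/-! ### Unitary frames and `det²` -/

section Frame

variable {V : Type*} [NormedAddCommGroup V] [InnerProductSpace ℝ V]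

theorem inner_horizontalVector (x : V) (z : SympSpace V) :
    inner ℝ (horizontalVector x) z = inner ℝ x z.fst := by
  simp [WithLp.prod_inner_apply, horizontalVector]

theorem inner_verticalVector (x : V) (z : SympSpace V) :
    inner ℝ (verticalVector x) z = inner ℝ x z.snd := by
  simp [WithLp.prod_inner_apply, verticalVector]

/-- The matrix of complex coordinates, with respect to the family `e`, of the family `v` in
`S(V) ≃ V ⊗ ℂ`. -/
def coordMatrix {ι κ : Type*} (e : ι → V) (v : κ → SympSpace V) : Matrix ι κ ℂ :=
  Matrix.of fun j k =>
    ((inner ℝ (e j) (v k).fst : ℝ) : ℂ) + ((inner ℝ (e j) (v k).snd : ℝ) : ℂ) * Complex.I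

variable {ι κ μ : Type*} [Fintype ι]

/-- The Hermitian product of `V ⊗ ℂ` has real part the inner product and imaginary part `omega`. On
a Lagrangian subspace Gram matrices are therefore real. -/
theorem conjTranspose_coordMatrix_mul (e : OrthonormalBasis ι ℝ V) (v : κ → SympSpace V)
    (w : μ → SympSpace V) :
    (coordMatrix e v)ᴴ * coordMatrix e w =
      Matrix.of fun j k => ((inner ℝ (v j) (w k) : ℝ) : ℂ) +
        (omega (v j) (w k) : ℂ) * Complex.I := by
  ext j k
  have hs : ∀ x y : V, (inner ℝ x y : ℝ) = ∑ i, inner ℝ (e i) x * inner ℝ (e i) y := fun x y => by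
    rw [← e.sum_inner_mul_inner x y]
    simp only [real_inner_comm]
  simp only [coordMatrix, Matrix.mul_apply, Matrix.conjTranspose_apply, Matrix.of_apply,
    WithLp.prod_inner_apply, omega]
  change _ = (((inner ℝ (v j).fst (w k).fst + inner ℝ (v j).snd (w k).snd : ℝ)) : ℂ) + _
  rw [real_inner_comm (v j).fst (w k).snd, hs (v j).fst (w k).fst, hs (v j).snd (w k).snd,
    hs (v j).fst (w k).snd, hs (v j).snd (w k).fst]
  push_cast
  rw [← Finset.sum_add_distrib, ← Finset.sum_sub_distrib, Finset.sum_mul,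
    ← Finset.sum_add_distrib]
  refine Finset.sum_congr rfl fun i _ => ?_
  simp only [star_add, star_mul', RCLike.star_def, Complex.conj_ofReal, Complex.conj_I]
  linear_combination (-(((inner ℝ (e i) (v j).snd : ℝ) : ℂ) *
    ((inner ℝ (e i) (w k).snd : ℝ) : ℂ))) * Complex.I_mul_I

theorem conjTranspose_coordMatrix_mul_of_mem (e : OrthonormalBasis ι ℝ V)
    (L : LagrangianGrassmannian V) {v : κ → SympSpace V} {w : μ → SympSpace V}
    (hv : ∀ k, v k ∈ L.space) (hw : ∀ k, w k ∈ L.space) :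
    (coordMatrix e v)ᴴ * coordMatrix e w =
      (Matrix.of fun j k => (inner ℝ (v j) (w k) : ℝ)).map Complex.ofRealHom := by
  rw [conjTranspose_coordMatrix_mul]
  ext j k
  simp [L.omega_eq_zero (hv j) (hw k)]

theorem LagrangianGrassmannian.nonempty_orthonormalBasis [FiniteDimensional ℝ V]
    (e : OrthonormalBasis ι ℝ V)
    (L : LagrangianGrassmannian V) : Nonempty (OrthonormalBasis ι ℝ L.space) := by
  have h : Module.finrank ℝ L.space = Fintype.card ι := by
    rw [show Module.finrank ℝ L.space = Module.finrank ℝ V from L.2.finrank_eq,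
      Module.finrank_eq_card_basis e.toBasis]
  exact ⟨(stdOrthonormalBasis ℝ L.space).reindex
    (Fintype.equivOfCardEq (by rw [Fintype.card_fin, h]))⟩

variable [DecidableEq ι]

theorem conjTranspose_coordMatrix_mul_self (e : OrthonormalBasis ι ℝ V)
    (L : LagrangianGrassmannian V) (f : OrthonormalBasis ι ℝ L.space) :
    (coordMatrix e fun k => (f k : SympSpace V))ᴴ * (coordMatrix e fun k => (f k : SympSpace V)) =
      1 := by
  rw [conjTranspose_coordMatrix_mul_of_mem e L (fun k => (f k).2) (fun k => (f k).2)]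
  ext j k
  have := orthonormal_iff_ite.1 f.orthonormal j k
  rw [Submodule.coe_inner] at this
  simp only [Matrix.map_apply, Matrix.of_apply, this, Matrix.one_apply]
  split_ifs <;> simp

theorem det_coordMatrix_mul_conj (e : OrthonormalBasis ι ℝ V) (L : LagrangianGrassmannian V)
    (f : OrthonormalBasis ι ℝ L.space) :
    conj (coordMatrix e fun k => (f k : SympSpace V)).det *
      (coordMatrix e fun k => (f k : SympSpace V)).det = 1 := by
  have := congrArg Matrix.det (conjTranspose_coordMatrix_mul_self e L f)
  rwa [Matrix.det_mul, Matrix.det_conjTranspose, Matrix.det_one] at this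

variable [FiniteDimensional ℝ V]

theorem detSq_eq_det_coordMatrix_sq (e : OrthonormalBasis ι ℝ V) (L : LagrangianGrassmannian V)
    (f : OrthonormalBasis ι ℝ L.space) :
    detSq L = (coordMatrix e fun k => (f k : SympSpace V)).det ^ 2 := by
  let σ : ι ≃ Fin (Fintype.card ι) := Fintype.equivFin ι
  rw [detSq_eq L (e.reindex σ) (f.reindex σ),
    ← Matrix.det_submatrix_equiv_self σ.symm (coordMatrix e _)]
  congr 2
  ext j k
  simp [frameMatrix, coordMatrix]

theorem norm_detSq (L : LagrangianGrassmannian V) : ‖detSq L‖ = 1 := by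
  let e := stdOrthonormalBasis ℝ V
  obtain ⟨f⟩ := L.nonempty_orthonormalBasis e
  have := congrArg norm (det_coordMatrix_mul_conj e L f)
  rw [norm_mul, RCLike.norm_conj, norm_one] at this
  rw [detSq_eq_det_coordMatrix_sq e L f, norm_pow, sq, this]

/-- `det²` can be computed from the coordinates of any family of vectors of `L`. -/
theorem detSq_mul_conj_det_coordMatrix (e : OrthonormalBasis ι ℝ V) (L : LagrangianGrassmannian V)
    {v : ι → SympSpace V} (hv : ∀ k, v k ∈ L.space) :
    detSq L * conj (coordMatrix e v).det = (coordMatrix e v).det := by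
  obtain ⟨f⟩ := L.nonempty_orthonormalBasis e
  have h1 := det_coordMatrix_mul_conj e L f
  have h2 := conjTranspose_coordMatrix_mul_of_mem e L (fun k => (f k).2) hv
  have h3 := mul_eq_one_comm.1 (conjTranspose_coordMatrix_mul_self e L f)
  rw [detSq_eq_det_coordMatrix_sq e L f]
  set X := coordMatrix e fun k => (f k : SympSpace V)
  set M := coordMatrix e v
  set R : Matrix ι ι ℝ := Matrix.of fun j k => inner ℝ (f j : SympSpace V) (v k)
  -- Any family in `L` differs from a unitary frame by a real matrix, whose determinant cancels
  -- between `det M` and its conjugate.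
  have h4 : M = X * R.map Complex.ofRealHom := by
    rw [← h2, ← Matrix.mul_assoc, h3, Matrix.one_mul]
  have h5 : (R.map Complex.ofRealHom).det = ((R.det : ℝ) : ℂ) :=
    (RingHom.map_det Complex.ofRealHom R).symm
  rw [h4, Matrix.det_mul, h5, map_mul, Complex.conj_ofReal]
  linear_combination X.det * R.det * h1

end Frame

/-! ### Continuity of `det²` -/

section Continuity

variable {V : Type*} [NormedAddCommGroup V] [InnerProductSpace ℝ V]

theorem LagrangianGrassmannian.continuous_projector [CompleteSpace V] :
    Continuous (projector : LagrangianGrassmannian V → _) :=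
  continuous_induced_dom

theorem LagrangianGrassmannian.continuous_inner_projector [CompleteSpace V] (x y : SympSpace V) :
    Continuous fun L : LagrangianGrassmannian V => (inner ℝ x (L.projector y) : ℝ) := by
  have : Continuous fun L : LagrangianGrassmannian V => L.projector y :=
    LagrangianGrassmannian.continuous_projector.clm_apply continuous_const
  fun_prop

theorem continuous_detSq [FiniteDimensional ℝ V] [CompleteSpace V] :
    Continuous (detSq : LagrangianGrassmannian V → ℂ) := by
  let e := stdOrthonormalBasis ℝ V
  -- This is `X Xᵀ` for a unitary frame `X` of `L`. Its entries depend only on `P_L`, while `det (X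
  -- Xᵀ) = (det X)²`.
  let W : LagrangianGrassmannian V → Matrix _ _ ℂ := fun L => Matrix.of fun j k =>
    (((inner ℝ (horizontalVector (e j)) (L.projector (horizontalVector (e k))) -
      inner ℝ (verticalVector (e j)) (L.projector (verticalVector (e k))) : ℝ)) : ℂ) +
    ((inner ℝ (horizontalVector (e j)) (L.projector (verticalVector (e k))) +
      inner ℝ (verticalVector (e j)) (L.projector (horizontalVector (e k))) : ℝ) : ℂ) * Complex.I
  have hW : Continuous W := by
    refine continuous_matrix fun j k => ?_
    have h := fun x y : SympSpace V => LagrangianGrassmannian.continuous_inner_projector x y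
    have h1 := h (horizontalVector (e j)) (horizontalVector (e k))
    have h2 := h (horizontalVector (e j)) (verticalVector (e k))
    have h3 := h (verticalVector (e j)) (horizontalVector (e k))
    have h4 := h (verticalVector (e j)) (verticalVector (e k))
    exact (Complex.continuous_ofReal.comp (h1.sub h4)).add
      ((Complex.continuous_ofReal.comp (h2.add h3)).mul continuous_const)
  have hdet : (detSq : LagrangianGrassmannian V → ℂ) = fun L => (W L).det := by
    funext L
    obtain ⟨f⟩ := L.nonempty_orthonormalBasis e
    have key : ∀ x y : SympSpace V, (inner ℝ x (L.projector y) : ℝ) =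
        ∑ m, inner ℝ x (f m : SympSpace V) * inner ℝ y (f m : SympSpace V) := by
      intro x y
      have h1 : L.projector y = ∑ m, inner ℝ (f m : SympSpace V) y • (f m : SympSpace V) := by
        have := congrArg (Subtype.val) (f.orthogonalProjectionOnto_apply_eq_sum y)
        rw [Submodule.coe_sum] at this
        exact this
      rw [h1, inner_sum]
      refine Finset.sum_congr rfl fun m _ => ?_
      rw [inner_smul_right, real_inner_comm, mul_comm, real_inner_comm]
    rw [detSq_eq_det_coordMatrix_sq e L f, sq]
    nth_rw 2 [← Matrix.det_transpose]
    rw [← Matrix.det_mul]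
    congr 1
    ext j k
    simp only [W, Matrix.mul_apply, Matrix.transpose_apply, coordMatrix, Matrix.of_apply, key]
    simp only [inner_horizontalVector, inner_verticalVector]
    push_cast
    rw [← Finset.sum_add_distrib, ← Finset.sum_sub_distrib, Finset.sum_mul,
      ← Finset.sum_add_distrib]
    refine Finset.sum_congr rfl fun m _ => ?_
    linear_combination (((inner ℝ (e j) (f m : SympSpace V).snd : ℝ) : ℂ) *
      ((inner ℝ (e k) (f m : SympSpace V).snd : ℝ) : ℂ)) * Complex.I_mul_I
  rw [hdet]
  exact hW.matrix_det

end Continuity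

/-! ### Angles on matrices with positive definite imaginary part -/

section Siegel

variable {κ : Type*} [Fintype κ]

variable (κ) in
/-- The complex matrices with positive definite imaginary part. -/
def imPosDef : Set (Matrix κ κ ℂ) := {D | ∀ z : κ → ℂ, z ≠ 0 → 0 < (star z ⬝ᵥ D *ᵥ z).im}

theorem convex_imPosDef : Convex ℝ (imPosDef κ) := by
  intro D hD D' hD' a b ha hb hab z hz
  have h1 := hD z hz
  have h2 := hD' z hz
  have e : (star z ⬝ᵥ (a • D + b • D') *ᵥ z).im =
      a * (star z ⬝ᵥ D *ᵥ z).im + b * (star z ⬝ᵥ D' *ᵥ z).im := by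
    rw [Matrix.add_mulVec, dotProduct_add, Matrix.smul_mulVec, Matrix.smul_mulVec,
      dotProduct_smul, dotProduct_smul]
    simp
  rw [e]
  rcases ha.eq_or_lt with rfl | ha
  · have : b = 1 := by linarith
    subst this
    simpa using h2
  · have := mul_pos ha h1
    have := mul_nonneg hb h2.le
    linarith

theorem det_ne_zero_of_mem_imPosDef [DecidableEq κ] {D : Matrix κ κ ℂ} (hD : D ∈ imPosDef κ) :
    D.det ≠ 0 := by
  intro h
  obtain ⟨z, hz, h0⟩ := Matrix.exists_mulVec_eq_zero_iff.2 h
  have := hD z hz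
  simp [h0] at this

/-- There is a continuous angle of `det D / conj (det D)` for the matrices `D` with positive
definite imaginary part. -/
theorem exists_angle_imPosDef [DecidableEq κ] :
    ∃ Ψ : Matrix κ κ ℂ → ℝ, ContinuousOn Ψ (imPosDef κ) ∧
      ∀ D ∈ imPosDef κ, D.det = Complex.exp (Ψ D * Complex.I) * conj D.det := by
  have hdet : Continuous fun D : Matrix κ κ ℂ => D.det := continuous_id.matrix_det
  obtain ⟨Ψ, h1, h2⟩ := exists_continuousOn_angle (convex_imPosDef (κ := κ))
    (f := fun D => D.det / conj D.det)
    (hdet.continuousOn.div (Complex.continuous_conj.comp hdet).continuousOn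
      fun D hD => by simpa using det_ne_zero_of_mem_imPosDef hD)
    (fun D hD => by
      rw [norm_div, RCLike.norm_conj, div_self]
      simpa using det_ne_zero_of_mem_imPosDef hD)
  refine ⟨Ψ, h1, fun D hD => ?_⟩
  rw [← h2 D hD, div_mul_cancel₀]
  simpa using det_ne_zero_of_mem_imPosDef hD

end Siegel

/-! ### The cross matrix and `det²` under reduction -/

section Cross

variable {V : Type*} [NormedAddCommGroup V] [InnerProductSpace ℝ V] [CompleteSpace V]

/-- The coordinates, with respect to the family `e`, of the projections to `L` of the vertical
vectors `(0, e k)`. -/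
noncomputable def crossMatrix {κ : Type*} (e : κ → V) (L : LagrangianGrassmannian V) :
    Matrix κ κ ℂ :=
  coordMatrix e fun k => L.projector (verticalVector (e k))

variable {κ : Type*}

theorem continuous_crossMatrix (e : κ → V) : Continuous (crossMatrix e) := by
  refine continuous_matrix fun j k => ?_
  have h1 := LagrangianGrassmannian.continuous_inner_projector (horizontalVector (e j))
    (verticalVector (e k))
  have h2 := LagrangianGrassmannian.continuous_inner_projector (verticalVector (e j))
    (verticalVector (e k))
  simp only [inner_horizontalVector, inner_verticalVector] at h1 h2
  exact (Complex.continuous_ofReal.comp h1).add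
    ((Complex.continuous_ofReal.comp h2).mul continuous_const)

/-- `omega` vanishes on `L` and also on `L^⊥ = J L`; expand `omega (z - P z) (w - P w) = 0`. -/
theorem omega_projector_comm (L : LagrangianGrassmannian V) (z w : SympSpace V) :
    omega z (L.projector w) + omega (L.projector z) w = omega z w := by
  have h1 := L.omega_eq_zero (L.projector_apply_mem z) (L.projector_apply_mem w)
  have h2 : omega (z - L.projector z) (w - L.projector w) = 0 := by
    obtain ⟨u, hu, h3⟩ := L.exists_complexJ_eq
      (Submodule.sub_starProjection_mem_orthogonal (K := L.space) w)
    have h4 := Submodule.starProjection_inner_eq_zero (K := L.space) z u hu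
    have h3' : w - L.projector w = complexJ u := h3.symm
    rw [omega_eq_inner, h3', inner_complexJ_complexJ]
    exact h4
  rw [omega_sub_left, omega_sub_right, omega_sub_right, h1] at h2
  linarith

theorem inner_horizontalVector_projector_comm (L : LagrangianGrassmannian V) (x y : V) :
    (inner ℝ (horizontalVector x) (L.projector (verticalVector y)) : ℝ) =
      inner ℝ (horizontalVector y) (L.projector (verticalVector x)) := by
  have h : ∀ (u : V) (w : SympSpace V),
      omega (verticalVector u) w = -inner ℝ (horizontalVector u) w := by
    intro u w
    rw [inner_horizontalVector]
    simp [omega, verticalVector]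
  have := omega_projector_comm L (verticalVector x) (verticalVector y)
  rw [omega_swap (L.projector _), h, h] at this
  have h0 : omega (verticalVector x) (verticalVector y) = 0 := by simp [omega, verticalVector]
  rw [h0] at this
  linarith

/-- Up to sign `(y, 0)` is `J (0, y)`, and `J` maps `L^⊥` to `L`. -/
theorem horizontalVector_mem_of_projector_eq_zero {L : LagrangianGrassmannian V} {y : V}
    (h : L.projector (verticalVector y) = 0) : horizontalVector y ∈ L.space := by
  rw [L.mem_space_iff]
  intro u hu
  have := Submodule.starProjection_inner_eq_zero (K := L.space) (verticalVector y) u hu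
  have h' : L.space.starProjection (verticalVector y) = 0 := h
  rw [h', sub_zero, inner_verticalVector] at this
  simp [omega, horizontalVector, real_inner_comm, this]

variable [Fintype κ]

/-- Write the matrix as `S + i N`. Here `S` is real symmetric, so it contributes nothing to the
imaginary part of `z* D z`. `N` is the Gram matrix of the projections of `(0, e k)` to `L`; it is
degenerate only if some nonzero `(y, 0)` with `y` in the span lies in `L`. -/
theorem crossMatrix_mem_imPosDef {e : κ → V} (he : LinearIndependent ℝ e)
    {L : LagrangianGrassmannian V}
    (hL : ∀ y ∈ Submodule.span ℝ (Set.range e), horizontalVector y ∈ L.space → y = 0) :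
    crossMatrix e L ∈ imPosDef κ := by
  have hpos : ∀ p : κ → ℝ, p ≠ 0 →
      0 < ∑ j, ∑ k, p j * p k * inner ℝ (e j) (L.projector (verticalVector (e k))).snd := by
    intro p hp
    have hv : verticalVector (∑ k, p k • e k) = ∑ k, p k • verticalVector (e k) := by
      apply sympSpace_ext
      · change (0 : V) = WithLp.fstₗ 2 ℝ V V _
        simp [verticalVector]
      · change (∑ k, p k • e k : V) = WithLp.sndₗ 2 ℝ V V _
        simp [verticalVector]
    have h1 : L.projector (verticalVector (∑ k, p k • e k)) ≠ 0 := by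
      intro h0
      have h2 := hL _ (Submodule.sum_mem _ fun k _ => Submodule.smul_mem _ _
        (Submodule.subset_span ⟨k, rfl⟩)) (horizontalVector_mem_of_projector_eq_zero h0)
      exact hp (funext (Fintype.linearIndependent_iff.1 he p h2))
    have h2 : (inner ℝ (verticalVector (∑ k, p k • e k))
        (L.projector (verticalVector (∑ k, p k • e k))) : ℝ) =
        ‖L.projector (verticalVector (∑ k, p k • e k))‖ ^ 2 := by
      rw [← real_inner_self_eq_norm_sq]
      have := Submodule.starProjection_inner_eq_zero (K := L.space)
        (verticalVector (∑ k, p k • e k)) _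
        (L.projector_apply_mem (verticalVector (∑ k, p k • e k)))
      rw [inner_sub_left, sub_eq_zero] at this
      exact this
    have h3 : 0 < ‖L.projector (verticalVector (∑ k, p k • e k))‖ ^ 2 := by positivity
    rw [← h2, hv, map_sum, sum_inner] at h3
    refine h3.trans_eq (Finset.sum_congr rfl fun j _ => ?_)
    rw [inner_sum]
    refine Finset.sum_congr rfl fun k _ => ?_
    rw [map_smul, inner_smul_left, inner_smul_right, inner_verticalVector]
    simp [mul_assoc]
  intro z hz
  set n : κ → κ → ℝ := fun j k => inner ℝ (e j) (L.projector (verticalVector (e k))).snd with hn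
  set s : κ → κ → ℝ := fun j k => inner ℝ (e j) (L.projector (verticalVector (e k))).fst with hs
  have hsymm : ∀ j k, s j k = s k j := by
    intro j k
    have := inner_horizontalVector_projector_comm L (e j) (e k)
    rwa [inner_horizontalVector, inner_horizontalVector] at this
  have him : (star z ⬝ᵥ crossMatrix e L *ᵥ z).im =
      (∑ j, ∑ k, (z j).re * (z k).re * n j k) + (∑ j, ∑ k, (z j).im * (z k).im * n j k) +
        ((∑ j, ∑ k, (z j).re * (z k).im * s j k) - ∑ j, ∑ k, (z j).im * (z k).re * s j k) := by
    simp only [dotProduct, mulVec, Finset.mul_sum, Complex.im_sum, ← Finset.sum_add_distrib,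
      ← Finset.sum_sub_distrib]
    refine Finset.sum_congr rfl fun j _ => Finset.sum_congr rfl fun k _ => ?_
    simp [crossMatrix, coordMatrix, hn, hs]
    ring
  have hzero : ∑ j, ∑ k, (z j).re * (z k).im * s j k = ∑ j, ∑ k, (z j).im * (z k).re * s j k := by
    rw [Finset.sum_comm]
    refine Finset.sum_congr rfl fun j _ => Finset.sum_congr rfl fun k _ => ?_
    rw [hsymm]
    ring
  rw [him, hzero, sub_self, add_zero]
  have hnn : ∀ p : κ → ℝ, 0 ≤ ∑ j, ∑ k, p j * p k * n j k := by
    intro p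
    by_cases hp : p = 0
    · simp [hp]
    · exact (hpos p hp).le
  by_cases hre : (fun j => (z j).re) = 0
  · have him' : (fun j => (z j).im) ≠ 0 := by
      intro h
      exact hz (funext fun j => Complex.ext (congrFun hre j) (congrFun h j))
    exact add_pos_of_nonneg_of_pos (hnn fun j => (z j).re) (hpos _ him')
  · exact add_pos_of_pos_of_nonneg (hpos _ hre) (hnn fun j => (z j).im)

variable [DecidableEq κ]

/-- `det²` of a Lagrangian subspace in terms of its reduction. -/
theorem detSq_mul_conj_det_crossMatrix {G ι : Type*} [NormedAddCommGroup G] [InnerProductSpace ℝ G]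
    [FiniteDimensional ℝ G] [FiniteDimensional ℝ V] [Fintype ι] [DecidableEq ι]
    {φ : G →ₗᵢ[ℝ] V} (eG : OrthonormalBasis ι ℝ G) (e : OrthonormalBasis (ι ⊕ κ) ℝ V)
    (he : ∀ i, e (Sum.inl i) = φ (eG i)) {L : LagrangianGrassmannian V}
    {L' : LagrangianGrassmannian G} (hL : L'.space ≤ reduce φ L.space) :
    detSq L * conj (crossMatrix (fun k => e (Sum.inr k)) L).det =
      detSq L' * (crossMatrix (fun k => e (Sum.inr k)) L).det := by
  obtain ⟨f⟩ := L'.nonempty_orthonormalBasis eG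
  choose z hz h1 h2 using fun i => mem_reduce.1 (hL (f i).2)
  set v : κ → SympSpace V := fun k => L.projector (verticalVector (e (Sum.inr k))) with hv
  have hvL : ∀ k, v k ∈ L.space := fun k => L.projector_apply_mem _
  set A := coordMatrix eG fun i => (f i : SympSpace G) with hA
  set B := coordMatrix (fun i => e (Sum.inl i)) v with hB
  set C := coordMatrix (fun k => e (Sum.inr k)) z with hC
  set D := crossMatrix (fun k => e (Sum.inr k)) L with hD
  -- The family in `L` consists of lifts `z` of an orthonormal basis of `L'` and the projected
  -- vertical vectors `v`.
  have hM : coordMatrix e (Sum.elim z v) = fromBlocks A B C D := by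
    ext (i | i) (j | j)
    · simp only [coordMatrix, hA, Matrix.of_apply, fromBlocks_apply₁₁, Sum.elim_inl, he, h1, h2,
        φ.inner_map_map]
    · rfl
    · rfl
    · rfl
  -- The lifts are orthogonal to the `v k`: `⟪z j, P_L (0, e k)⟫ = ⟪(z j).snd, e k⟫`, and `(z
  -- j).snd` lies in `range φ`.
  have hgram : Aᴴ * B + Cᴴ * D = 0 := by
    have h3 := conjTranspose_coordMatrix_mul_of_mem e L hz hvL
    have h4 : (Matrix.of fun j k => (inner ℝ (z j) (v k) : ℝ)) = 0 := by
      ext j k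
      have h5 := Submodule.starProjection_inner_eq_zero (K := L.space)
        (verticalVector (e (Sum.inr k))) (z j) (hz j)
      rw [inner_sub_left, sub_eq_zero, inner_verticalVector, h2] at h5
      have h6 : inner ℝ (e (Sum.inr k)) (φ (f j : SympSpace G).snd) = 0 := by
        rw [← eG.sum_repr' (f j : SympSpace G).snd, map_sum, inner_sum]
        refine Finset.sum_eq_zero fun i _ => ?_
        rw [map_smul, inner_smul_right, ← he,
          e.orthonormal.2 (by simp : (Sum.inr k : ι ⊕ κ) ≠ Sum.inl i), mul_zero]
      rw [h6] at h5
      rw [Matrix.of_apply, real_inner_comm]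
      exact h5.symm
    rw [h4] at h3
    have h7 : coordMatrix e z = fromRows A C := by
      ext (i | i) j
      · simp only [coordMatrix, hA, Matrix.of_apply, fromRows_apply_inl, he, h1, h2,
          φ.inner_map_map]
      · rfl
    have h8 : coordMatrix e v = fromRows B D := by
      ext (i | i) j <;> rfl
    rw [h7, h8, conjTranspose_fromRows_eq_fromCols_conjTranspose, fromCols_mul_fromRows] at h3
    rw [h3]
    ext
    simp
  have hAA : A * Aᴴ = 1 := mul_eq_one_comm.1 (conjTranspose_coordMatrix_mul_self eG L' f)
  have hBeq : B = A * (-(Cᴴ * D)) := by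
    rw [← eq_neg_of_add_eq_zero_left hgram, ← Matrix.mul_assoc, hAA, Matrix.one_mul]
  -- Unitarity of `A` gives `B = -A Cᴴ D`. Eliminating `B` leaves `det A · det (1 + C Cᴴ) · det D`,
  -- whose middle factor is positive and cancels in `det / conj det`.
  have hfac : fromBlocks A B C D =
      fromBlocks A 0 C ((1 + C * Cᴴ) * D) * fromBlocks 1 (-(Cᴴ * D)) 0 1 := by
    rw [fromBlocks_multiply]
    congr 1
    · simp
    · simp [hBeq]
    · simp
    · simp [Matrix.add_mul, Matrix.mul_assoc]
  have hpd : (1 + C * Cᴴ).PosDef :=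
    PosDef.one.add_posSemidef (posSemidef_self_mul_conjTranspose C)
  have hr : conj (1 + C * Cᴴ).det = (1 + C * Cᴴ).det := by
    have := congrArg Matrix.det hpd.isHermitian.eq
    rwa [det_conjTranspose] at this
  have key := detSq_mul_conj_det_coordMatrix e L (v := Sum.elim z v)
    (by rintro (i | i); exacts [hz i, hvL i])
  have ha : conj A.det * A.det = 1 := det_coordMatrix_mul_conj eG L' f
  rw [hM, hfac, det_mul, det_fromBlocks_zero₁₂, det_fromBlocks_zero₂₁, det_mul, det_one, det_one,
    mul_one, mul_one, map_mul, map_mul, hr] at key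
  rw [detSq_eq_det_coordMatrix_sq eG L' f, ← hA]
  refine mul_left_cancel₀ hpd.det_pos.ne' ?_
  linear_combination A.det * key - detSq L * conj D.det * (1 + C * Cᴴ).det * ha

end Cross

end FredholmMaslov

namespace FredholmMaslov

open Set Filter Topology

open scoped ComplexConjugate

/-! ### Transverse Lagrangians as graphs of symmetric operators -/

section Graph

theorem norm_snd_le {V : Type*} [NormedAddCommGroup V] (z : WithLp 2 (V × V)) : ‖z.snd‖ ≤ ‖z‖ := by
  rw [← sq_le_sq₀ (norm_nonneg _) (norm_nonneg _), WithLp.prod_norm_sq_eq_of_L2]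
  nlinarith [sq_nonneg ‖z.fst‖]

variable {V : Type*} [NormedAddCommGroup V] [InnerProductSpace ℝ V]

/-- The graph `{(T y, y)}` of a linear operator over the vertical space. -/
def verticalGraph (T : V →ₗ[ℝ] V) : Submodule ℝ (SympSpace V) where
  carrier := {z | z.fst = T z.snd}
  zero_mem' := by simp
  add_mem' := by
    intro z w hz hw
    simp_all
  smul_mem' := by
    intro c z hz
    simp_all

theorem isLagrangian_verticalGraph {T : V →ₗ[ℝ] V} (hT : T.IsSymmetric) :
    IsLagrangian (verticalGraph T) := by
  apply le_antisymm
  · intro z hz u hu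
    have hz' : z.fst = T z.snd := hz
    have hu' : u.fst = T u.snd := hu
    rw [omega, hz', hu', ← hT, real_inner_comm, sub_self]
  · intro z hz
    refine ext_inner_left ℝ fun y => ?_
    have := hz (WithLp.toLp 2 (T y, y)) rfl
    have h2 : inner ℝ z.snd (T y) - inner ℝ y z.fst = 0 := this
    rw [← hT, real_inner_comm z.snd (T y)]
    linarith

/-- The graph of a symmetric operator over the vertical space, as a point of `Λ(V)`. -/
def graphPoint (T : V →ₗ[ℝ] V) (hT : T.IsSymmetric) : LagrangianGrassmannian V :=
  ⟨verticalGraph T, isLagrangian_verticalGraph hT⟩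

theorem mem_graphPoint {T : V →ₗ[ℝ] V} {hT : T.IsSymmetric} {z : SympSpace V} :
    z ∈ (graphPoint T hT).space ↔ z.fst = T z.snd :=
  Iff.rfl

theorem isTransverse_graphPoint {T : V →ₗ[ℝ] V} {hT : T.IsSymmetric} :
    IsTransverse (graphPoint T hT).space (horizontalFrame V) := by
  refine IsCompl.of_eq ?_ ?_
  · rw [eq_bot_iff]
    rintro z ⟨h1, -, h2⟩
    have h1' : z.fst = T z.snd := h1
    rw [h2, map_zero] at h1'
    exact sympSpace_ext h1' h2
  · rw [eq_top_iff]
    intro z _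
    have h3 : z = WithLp.toLp 2 (T z.snd, z.snd) + horizontalVector (z.fst - T z.snd) := by
      apply sympSpace_ext <;> simp [horizontalVector]
    rw [h3]
    exact Submodule.add_mem_sup (show _ = _ from rfl) ⟨trivial, rfl⟩

theorem dist_graphPoint_le [CompleteSpace V] {T T' : V →ₗ[ℝ] V} {hT : T.IsSymmetric}
    {hT' : T'.IsSymmetric} {K : ℝ} (hK : 0 ≤ K) (h : ∀ y, ‖T y - T' y‖ ≤ K * ‖y‖) :
    dist (graphPoint T hT) (graphPoint T' hT') ≤ 2 * K := by
  refine LagrangianGrassmannian.dist_le_of_omega hK fun u hu w hw => ?_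
  rw [mem_graphPoint] at hu hw
  have e : omega u w = inner ℝ (T u.snd - T' u.snd) w.snd := by
    rw [omega, hu, hw, ← hT', inner_sub_left, real_inner_comm]
  rw [e]
  refine (abs_real_inner_le_norm _ _).trans ?_
  have := h u.snd
  have := norm_snd_le u
  have := norm_snd_le w
  calc _ ≤ (K * ‖u.snd‖) * ‖w.snd‖ := by gcongr
    _ ≤ _ := by gcongr

/-- A Lagrangian subspace that is transverse to the horizontal frame is the graph of a symmetric
operator. -/
theorem exists_eq_graphPoint {L : LagrangianGrassmannian V}
    (h : IsTransverse L.space (horizontalFrame V)) :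
    ∃ (T : V →ₗ[ℝ] V) (hT : T.IsSymmetric), L = graphPoint T hT := by
  let p : L.space →ₗ[ℝ] V := (WithLp.sndₗ 2 ℝ V V) ∘ₗ L.space.subtype
  have hp : ∀ z, p z = (z : SympSpace V).snd := fun z => rfl
  have hbij : Function.Bijective p := by
    constructor
    · rw [injective_iff_map_eq_zero]
      intro z hz
      have h1 : (z : SympSpace V) ∈ L.space ⊓ horizontalFrame V := ⟨z.2, trivial, hz⟩
      rw [h.inf_eq_bot, Submodule.mem_bot] at h1
      exact Subtype.ext h1
    · intro y
      have h1 : verticalVector y ∈ L.space ⊔ horizontalFrame V := by rw [h.sup_eq_top]; trivial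
      obtain ⟨z, hz, i, ⟨-, hi⟩, hzi⟩ := Submodule.mem_sup.1 h1
      have h2 : z.snd + i.snd = y := congrArg WithLp.snd hzi
      exact ⟨⟨z, hz⟩, by rw [hp, ← h2, hi, add_zero]⟩
  let E := LinearEquiv.ofBijective p hbij
  let T : V →ₗ[ℝ] V := (WithLp.fstₗ 2 ℝ V V) ∘ₗ L.space.subtype ∘ₗ E.symm.toLinearMap
  have hE : ∀ y, (E.symm y : SympSpace V).snd = y := fun y => E.apply_symm_apply y
  have hTE : ∀ y, T y = (E.symm y : SympSpace V).fst := fun y => rfl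
  have hT : T.IsSymmetric := by
    intro x y
    have h1 := L.omega_eq_zero (E.symm x).2 (E.symm y).2
    rw [omega, hE, hE, ← hTE, ← hTE] at h1
    rw [real_inner_comm]
    linarith
  refine ⟨T, hT, Subtype.ext (Submodule.ext fun z => ?_)⟩
  constructor
  · intro hz
    have : E.symm z.snd = ⟨z, hz⟩ := by
      rw [LinearEquiv.symm_apply_eq]
      rfl
    change z.fst = T z.snd
    rw [hTE, this]
  · intro hz
    have hz' : z.fst = T z.snd := hz
    have : z = E.symm z.snd := sympSpace_ext (by rw [hz', hTE]) (hE _).symm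
    rw [this]
    exact (E.symm z.snd).2

end Graph

/-! ### Existence of the finite-dimensional Maslov index -/

section ClosingLoop

variable {V : Type*} [NormedAddCommGroup V] [InnerProductSpace ℝ V] [FiniteDimensional ℝ V]
  [CompleteSpace V]

/-- Two Lagrangian subspaces that are transverse to the horizontal frame can be joined by a path of
such subspaces. -/
theorem exists_path_transverse {L M : LagrangianGrassmannian V}
    (hL : IsTransverse L.space (horizontalFrame V))
    (hM : IsTransverse M.space (horizontalFrame V)) :
    ∃ p : ℝ → LagrangianGrassmannian V, Continuous p ∧ p 0 = L ∧ p 1 = M ∧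
      ∀ t, IsTransverse (p t).space (horizontalFrame V) := by
  obtain ⟨T, hT, rfl⟩ := exists_eq_graphPoint hL
  obtain ⟨T', hT', rfl⟩ := exists_eq_graphPoint hM
  -- Symmetric operators form a vector space, so graphs can be joined by interpolating the
  -- operators.
  let S : ℝ → V →ₗ[ℝ] V := fun t => T + t • (T' - T)
  have hS : ∀ t, (S t).IsSymmetric := fun t =>
    hT.add ((hT'.sub hT).smul (by simp))
  refine ⟨fun t => graphPoint (S t) (hS t), ?_, ?_, ?_, fun t => isTransverse_graphPoint⟩
  · let D := LinearMap.toContinuousLinearMap (T' - T)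
    refine LipschitzWith.continuous (K := Real.toNNReal (2 * ‖D‖)) ?_
    refine LipschitzWith.of_dist_le_mul fun s t => ?_
    rw [Real.coe_toNNReal _ (by positivity), Real.dist_eq, mul_assoc, mul_comm ‖D‖]
    refine dist_graphPoint_le (by positivity) fun y => ?_
    have : S s y - S t y = (s - t) • D y := by
      simp [S, D, sub_smul]
    rw [this, norm_smul, Real.norm_eq_abs, mul_assoc]
    gcongr
    exact D.le_opNorm y
  · simp [S]
  · simp [S]

theorem exists_isClosingLoop {l : ℝ → LagrangianGrassmannian V} {a b : ℝ} (hab : a ≤ b)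
    (hl : ContinuousOn l (Icc a b)) (ha : IsTransverse (l a).space (horizontalFrame V))
    (hb : IsTransverse (l b).space (horizontalFrame V)) :
    ∃ c lbar, IsClosingLoop (frameLagrangian V) l a b c lbar := by
  obtain ⟨p, hp, h0, h1, h2⟩ := exists_path_transverse hb ha
  have h3 : ∀ t ∈ Icc b (b + 1), (if t ≤ b then l t else p (t - b)) = p (t - b) := by
    intro t ht
    split_ifs with h
    · have : t = b := le_antisymm h ht.1
      rw [this, sub_self, h0]
    · rfl
  refine ⟨b + 1, fun t => if t ≤ b then l t else p (t - b), by simp, ?_, ?_, ?_, ?_⟩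
  · rw [← Icc_union_Icc_eq_Icc hab (by simp : b ≤ b + 1)]
    refine ContinuousOn.union_of_isClosed ?_ ?_ isClosed_Icc isClosed_Icc
    · exact hl.congr fun t ht => by simp [ht.2]
    · exact (hp.comp (continuous_id.sub continuous_const)).continuousOn.congr h3
  · intro t ht
    simp [ht.2]
  · intro t ht
    rw [h3 t ht]
    exact h2 _
  · simp [h1]

/-- There is a continuous angle of `det²` on the set of Lagrangian subspaces that are transverse to
the horizontal frame. -/
theorem exists_angle_transverse :
    ∃ Θ : LagrangianGrassmannian V → ℝ,
      ContinuousOn Θ {L | IsTransverse L.space (horizontalFrame V)} ∧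
      ∀ L : LagrangianGrassmannian V, IsTransverse L.space (horizontalFrame V) →
        detSq L = Complex.exp (Θ L * Complex.I) := by
  let e := stdOrthonormalBasis ℝ V
  obtain ⟨Ψ, h1, h2⟩ := exists_angle_imPosDef (κ := Fin (Module.finrank ℝ V))
  have h3 : ∀ L : LagrangianGrassmannian V, IsTransverse L.space (horizontalFrame V) →
      crossMatrix e L ∈ imPosDef (Fin (Module.finrank ℝ V)) := by
    intro L hL
    refine crossMatrix_mem_imPosDef e.orthonormal.linearIndependent fun y _ hy => ?_
    have : horizontalVector y ∈ L.space ⊓ horizontalFrame V := ⟨hy, trivial, rfl⟩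
    rw [hL.inf_eq_bot, Submodule.mem_bot] at this
    exact congrArg WithLp.fst this
  refine ⟨fun L => Ψ (crossMatrix e L), ?_, fun L hL => ?_⟩
  · exact h1.comp (continuous_crossMatrix e).continuousOn h3
  · have h4 : detSq L * conj (crossMatrix e L).det = (crossMatrix e L).det :=
      detSq_mul_conj_det_coordMatrix e L fun k => L.projector_apply_mem _
    have h5 : conj (crossMatrix e L).det ≠ 0 := by
      simpa using det_ne_zero_of_mem_imPosDef (h3 L hL)
    exact mul_right_cancel₀ h5 (h4.trans (h2 _ (h3 L hL)))

theorem exp_mul_I_eq_iff {x y : ℝ} :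
    Complex.exp (x * Complex.I) = Complex.exp (y * Complex.I) ↔
      ∃ m : ℤ, x - y = 2 * Real.pi * m := by
  rw [Complex.exp_eq_exp_iff_exists_int]
  refine exists_congr fun m => ?_
  constructor
  · intro h
    have := congrArg Complex.im h
    simp at this
    rw [this]
    ring
  · intro h
    rw [show x = y + 2 * Real.pi * m by linarith]
    push_cast
    ring

/-- Two lifts differ by a continuous function with values in the discrete group `2πℤ`, which is
constant on an interval. -/
theorem IsWindingNumber.unique {γ : ℝ → ℂ} {a c : ℝ} (hac : a ≤ c) {m m' : ℤ}
    (h : IsWindingNumber γ a c m) (h' : IsWindingNumber γ a c m') : m = m' := by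
  obtain ⟨θ, h1, h2, h3⟩ := h
  obtain ⟨θ', h1', h2', h3'⟩ := h'
  have hmaps : MapsTo (fun t => θ t - θ' t) (Icc a c)
      (AddSubgroup.zmultiples (2 * Real.pi) : Set ℝ) := by
    intro t ht
    obtain ⟨k, hk⟩ := exp_mul_I_eq_iff.1 ((h2 t ht).symm.trans (h2' t ht))
    exact ⟨k, by simp only [hk, zsmul_eq_mul]; ring⟩
  have hd : DiscreteTopology (AddSubgroup.zmultiples (2 * Real.pi)) := inferInstance
  have := isPreconnected_Icc.constant_of_mapsTo
    (T := (AddSubgroup.zmultiples (2 * Real.pi) : Set ℝ)) ⟨hd⟩ (h1.sub h1') hmaps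
    (left_mem_Icc.2 hac) (right_mem_Icc.2 hac)
  have h4 : 2 * Real.pi * ((m : ℝ) - m') = 0 := by
    simp only [Pi.sub_apply] at this
    linarith
  have h5 : (m : ℝ) - m' = 0 := by
    simpa [Real.pi_ne_zero] using h4
  exact_mod_cast sub_eq_zero.1 h5

/-- A path of Lagrangian subspaces with endpoints transverse to the horizontal frame has a Maslov
index. -/
theorem exists_isMaslovIndex {l : ℝ → LagrangianGrassmannian V} {a b : ℝ} (hab : a ≤ b)
    (hl : ContinuousOn l (Icc a b)) (ha : IsTransverse (l a).space (horizontalFrame V))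
    (hb : IsTransverse (l b).space (horizontalFrame V)) :
    ∃ m, IsMaslovIndex (frameLagrangian V) l a b m := by
  obtain ⟨Θ, hΘ, hΘ'⟩ := exists_angle_transverse (V := V)
  obtain ⟨θ, hθ, hθ'⟩ := exists_continuousOn_angle (convex_Icc a b)
    (continuous_detSq.comp_continuousOn hl) (fun t _ => norm_detSq (l t))
  have ha' := hθ' a (left_mem_Icc.2 hab)
  have hb' := hθ' b (right_mem_Icc.2 hab)
  simp only [Function.comp_apply] at ha' hb' hθ'
  obtain ⟨m, hm⟩ := exp_mul_I_eq_iff.1 (ha'.symm.trans (hΘ' _ ha))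
  obtain ⟨m', hm'⟩ := exp_mul_I_eq_iff.1 (hb'.symm.trans (hΘ' _ hb))
  -- `m` and `m'` measure how far the lift `θ` along `l` is from the angle `Θ` at the two ends.
  -- Continuing `θ` by `Θ` along any transverse arc gives total variation `2π (m' - m)`, whatever
  -- the arc.
  refine ⟨m' - m, exists_isClosingLoop hab hl ha hb, fun c lbar h => ?_⟩
  have hlb : lbar b = l b := h.eq b (right_mem_Icc.2 hab)
  have h3 : ∀ t ∈ Icc b c, (if t ≤ b then θ t else θ b + (Θ (lbar t) - Θ (lbar b))) =
      θ b + (Θ (lbar t) - Θ (lbar b)) := by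
    intro t ht
    split_ifs with h
    · have : t = b := le_antisymm h ht.1
      rw [this]
      ring
    · rfl
  refine ⟨fun t => if t ≤ b then θ t else θ b + (Θ (lbar t) - Θ (lbar b)), ?_, ?_, ?_⟩
  · rw [← Icc_union_Icc_eq_Icc hab h.le]
    refine ContinuousOn.union_of_isClosed ?_ ?_ isClosed_Icc isClosed_Icc
    · exact hθ.congr fun t ht => by simp [ht.2]
    · refine ContinuousOn.congr ?_ h3
      have : ContinuousOn (fun t => Θ (lbar t)) (Icc b c) :=
        hΘ.comp (h.continuousOn.mono (Icc_subset_Icc_left hab)) h.transverse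
      exact continuousOn_const.add (this.sub continuousOn_const)
  · intro t ht
    rcases le_total t b with htb | htb
    · simp only [htb, if_true, h.eq t ⟨ht.1, htb⟩]
      exact hθ' t ⟨ht.1, htb⟩
    · simp only [h3 t ⟨htb, ht.2⟩]
      rw [hΘ' _ (h.transverse t ⟨htb, ht.2⟩), exp_mul_I_eq_iff, hlb]
      exact ⟨-m', by push_cast; linarith⟩
  · have hc := h3 c ⟨h.le, le_rfl⟩
    rw [h.closed, hlb] at hc
    simp only [h.closed, hlb, hc, hab, if_true]
    push_cast
    linarith

end ClosingLoop

/-! ### Invariance of winding number and index under reduction -/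

section WindingReduction

/-- An orthonormal basis of `G` can be completed to one of `V`. -/
theorem exists_orthonormalBasis_sum {G V : Type*} [NormedAddCommGroup G]
    [InnerProductSpace ℝ G] [FiniteDimensional ℝ G] [NormedAddCommGroup V] [InnerProductSpace ℝ V]
    [FiniteDimensional ℝ V] (φ : G →ₗᵢ[ℝ] V) :
    ∃ (n k : ℕ) (eG : OrthonormalBasis (Fin n) ℝ G) (e : OrthonormalBasis (Fin n ⊕ Fin k) ℝ V),
      ∀ i, e (Sum.inl i) = φ (eG i) := by
  let K := LinearMap.range φ.toLinearMap
  let eG := stdOrthonormalBasis ℝ G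
  let e := ((eG.map φ.equivRange).prod (stdOrthonormalBasis ℝ Kᗮ)).map
    K.orthogonalDecomposition.symm
  refine ⟨_, _, eG, e, fun i => ?_⟩
  simp only [e, OrthonormalBasis.map_apply]
  rw [LinearIsometryEquiv.symm_apply_eq, Submodule.orthogonalDecomposition_apply,
    OrthonormalBasis.prod_apply]
  have h1 : φ (eG i) ∈ K := ⟨eG i, rfl⟩
  have h2 : K.orthogonalProjectionOnto (φ (eG i)) = ⟨φ (eG i), h1⟩ :=
    Submodule.orthogonalProjectionOnto_mem_subspace_eq_self (⟨φ (eG i), h1⟩ : K)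
  have h3 : Kᗮ.orthogonalProjectionOnto (φ (eG i)) = 0 :=
    Submodule.orthogonalProjectionOnto_orthogonal_apply_eq_zero h1
  simp only [h2, h3]
  rfl

variable {G V : Type*} [NormedAddCommGroup G] [InnerProductSpace ℝ G] [FiniteDimensional ℝ G]
  [CompleteSpace G] [NormedAddCommGroup V] [InnerProductSpace ℝ V] [FiniteDimensional ℝ V]
  [CompleteSpace V]

/-- Reduction does not change the winding number of a loop. -/
theorem IsWindingNumber.reducePoint {φ : G →ₗᵢ[ℝ] V} {l : ℝ → LagrangianGrassmannian V} {a c : ℝ}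
    {m : ℤ} (hl : ContinuousOn l (Icc a c))
    (hclean : ∀ t ∈ Icc a c, CleanAlong φ (l t).space) (hloop : l c = l a)
    (h : IsWindingNumber (fun t => detSq (l t)) a c m) :
    IsWindingNumber (fun t => detSq (reducePoint φ (l t))) a c m := by
  obtain ⟨n, k, eG, e, he⟩ := exists_orthonormalBasis_sum φ
  obtain ⟨Ψ, hΨ, hΨ'⟩ := exists_angle_imPosDef (κ := Fin k)
  obtain ⟨θ, h1, h2, h3⟩ := h
  let D : LagrangianGrassmannian V → Matrix (Fin k) (Fin k) ℂ :=
    crossMatrix fun j => e (Sum.inr j)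
  have hD : ∀ t ∈ Icc a c, D (l t) ∈ imPosDef (Fin k) := by
    intro t ht
    refine crossMatrix_mem_imPosDef
      (e.orthonormal.linearIndependent.comp _ Sum.inr_injective) fun y hy hyL => ?_
    obtain ⟨δ, hδ, hc⟩ := hclean t ht
    have hy' : ∀ g, inner ℝ (φ g) y = 0 := by
      intro g
      have hle : Submodule.span ℝ (range fun j => e (Sum.inr j)) ≤ (ℝ ∙ φ g)ᗮ := by
        rw [Submodule.span_le]
        rintro _ ⟨j, rfl⟩
        rw [SetLike.mem_coe, Submodule.mem_orthogonal_singleton_iff_inner_right,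
          ← eG.sum_repr' g, map_sum, sum_inner]
        refine Finset.sum_eq_zero fun i _ => ?_
        rw [map_smul, inner_smul_left, ← he,
          e.orthonormal.2 (by simp : (Sum.inl i : Fin n ⊕ Fin k) ≠ Sum.inr j), mul_zero]
      exact Submodule.mem_orthogonal_singleton_iff_inner_right.1 (hle hy)
    have := hc y hy' _ hyL
    rw [sub_self, norm_zero] at this
    exact norm_le_zero_iff.1 (nonpos_of_mul_nonpos_right this hδ)
  -- The correction `Ψ (D (l t))` depends only on the point `l t`, so it cancels between the
  -- endpoints of the loop.
  refine ⟨fun t => θ t - Ψ (D (l t)), ?_, fun t ht => ?_, ?_⟩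
  · exact h1.sub (hΨ.comp ((continuous_crossMatrix _).comp_continuousOn hl) hD)
  · have h4 := detSq_mul_conj_det_crossMatrix eG e he (L := l t)
      (L' := FredholmMaslov.reducePoint φ (l t))
      (space_reducePoint (hclean t ht)).le
    have h5 : conj (D (l t)).det ≠ 0 := by
      simpa using det_ne_zero_of_mem_imPosDef (hD t ht)
    have h6 := hΨ' _ (hD t ht)
    have h7 : detSq (l t) =
        detSq (FredholmMaslov.reducePoint φ (l t)) * Complex.exp (Ψ (D (l t)) * Complex.I) := by
      refine mul_right_cancel₀ h5 (h4.trans ?_)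
      rw [mul_assoc, ← h6]
    have h8 := h2 t ht
    simp only at h8
    rw [h7] at h8
    push_cast
    rw [sub_mul, Complex.exp_sub, ← h8, mul_div_cancel_right₀ _ (Complex.exp_ne_zero _)]
  · simp only [hloop]
    linarith

/-- Reduction does not change the Maslov index. -/
theorem IsMaslovIndex.eq_of_reduce {φ : G →ₗᵢ[ℝ] V} {l : ℝ → LagrangianGrassmannian V}
    {l' : ℝ → LagrangianGrassmannian G} {a b : ℝ} {m m' : ℤ} (hab : a ≤ b)
    (hclean : ∀ t ∈ Icc a b, CleanAlong φ (l t).space)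
    (hred : ∀ t ∈ Icc a b, (l' t).space = reduce φ (l t).space)
    (h : IsMaslovIndex (frameLagrangian V) l a b m)
    (h' : IsMaslovIndex (frameLagrangian G) l' a b m') : m = m' := by
  obtain ⟨⟨c, lbar, hc⟩, hw⟩ := h
  have hac := hab.trans hc.le
  have hclean' : ∀ t ∈ Icc a c, CleanAlong φ (lbar t).space := by
    intro t ht
    rcases le_total t b with htb | htb
    · rw [hc.eq t ⟨ht.1, htb⟩]
      exact hclean t ⟨ht.1, htb⟩
    · exact (hc.transverse t ⟨htb, ht.2⟩).cleanAlong φ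
  have heq : ∀ t ∈ Icc a b, reducePoint φ (l t) = l' t := by
    intro t ht
    exact Subtype.ext ((space_reducePoint (hclean t ht)).trans (hred t ht).symm)
  have hcl : lbar c = lbar a := hc.closed.trans (hc.eq a (left_mem_Icc.2 hab)).symm
  -- Reducing a whole closing loop of `l` gives a closing loop of `l'`, since transversality to the
  -- horizontal frame passes to reductions.
  have hc' : IsClosingLoop (frameLagrangian G) l' a b c fun t => reducePoint φ (lbar t) := by
    refine ⟨hc.le, (continuousOn_reducePoint φ).comp hc.continuousOn hclean', fun t ht => ?_,
      fun t ht => ?_, ?_⟩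
    · rw [hc.eq t ht, heq t ht]
    · rw [space_reducePoint (hclean' t ⟨hab.trans ht.1, ht.2⟩)]
      exact (hc.transverse t ht).reduce φ
    · rw [hc.closed, heq a (left_mem_Icc.2 hab)]
  exact ((hw c lbar hc).reducePoint hc.continuousOn hclean' hcl).unique hac (h'.2 _ _ hc')

end WindingReduction

end FredholmMaslov

namespace FredholmMaslov

open Set Filter Topology

/-! ### Admissible subspaces and independence of the choice -/

section Admissible

theorem CleanAlong.mono {H : Type*} [NormedAddCommGroup H] [InnerProductSpace ℝ H]
    {Y Z : Submodule ℝ H} (hYZ : Y ≤ Z) {L : Submodule ℝ (SympSpace H)}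
    (h : CleanAlong Y.subtypeₗᵢ L) : CleanAlong Z.subtypeₗᵢ L := by
  obtain ⟨c, hc, h⟩ := h
  exact ⟨c, hc, fun x hx => h x fun g => hx ⟨g, hYZ g.2⟩⟩

variable {H : Type*} [NormedAddCommGroup H] [InnerProductSpace ℝ H] [CompleteSpace H]

theorem cleanAlong_subtype_iff (Y : Submodule ℝ H) (L : LagrangianGrassmannian H) :
    CleanAlong Y.subtypeₗᵢ L.space ↔ HasCleanIntersection L.space (horizontal Yᗮ) := by
  rw [cleanAlong_iff]
  have : LinearMap.range Y.subtypeₗᵢ.toLinearMap = Y := Y.range_subtype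
  rw [this]

theorem cleanAlong_orthogonal_iff {I : Submodule ℝ H} (hI : IsClosed (I : Set H))
    (L : LagrangianGrassmannian H) :
    CleanAlong Iᗮ.subtypeₗᵢ L.space ↔ HasCleanIntersection L.space (horizontal I) := by
  have := hI.completeSpace_coe
  rw [cleanAlong_subtype_iff, Submodule.orthogonal_orthogonal]

/-- A Lagrangian subspace that forms a Fredholm pair with the horizontal frame has a clean
intersection with `I × {0}` for some `I` of finite codimension. -/
theorem exists_cleanAlong_of_fredholm {L : LagrangianGrassmannian H}
    (hL : L ∈ fredholmLagrangianGrassmannian H) :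
    ∃ Y : Submodule ℝ H, FiniteDimensional ℝ Y ∧ CleanAlong Y.subtypeₗᵢ L.space := by
  have hL' : IsFredholmPair (horizontalFrame H) L.space := hL
  have := hL'.finite_inf
  obtain ⟨c, hc, h⟩ := exists_le_norm_sub_of_isClosed_sup hL'.isClosed_left hL'.isClosed_right
    hL'.isClosed_sup
  -- Horizontal vectors orthogonal to `H₀ ∩ L` make an angle bounded below with `L`, as `H₀ + L` is
  -- closed.
  refine ⟨(horizontalFrame H ⊓ L.space).map (WithLp.fstₗ 2 ℝ H H), inferInstance, c, hc,
    fun x hx z hz => ?_⟩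
  rw [← norm_horizontalVector x]
  refine h _ ⟨⟨trivial, rfl⟩, ?_⟩ z hz
  refine (Submodule.mem_orthogonal _ _).2 fun u hu => ?_
  rw [real_inner_comm, inner_horizontalVector, real_inner_comm]
  exact hx ⟨u.fst, u, hu, rfl⟩

/-- Working with `Y = I^⊥`, cleanness is an open condition and persists when `Y` grows. By
compactness a finite sum of local choices of `Y` serves all of `[a, b]`. -/
theorem exists_isCleanFor {𝓛 : ℝ → LagrangianGrassmannian H} {a b : ℝ}
    (hcont : ContinuousOn 𝓛 (Icc a b))
    (hfred : ∀ t ∈ Icc a b, 𝓛 t ∈ fredholmLagrangianGrassmannian H) :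
    ∃ I : Submodule ℝ H, FiniteDimensional ℝ (H ⧸ I) ∧ IsCleanFor I 𝓛 a b := by
  obtain ⟨Y, hY, h⟩ : ∃ Y : Submodule ℝ H, FiniteDimensional ℝ Y ∧
      ∀ t ∈ Icc a b, CleanAlong Y.subtypeₗᵢ (𝓛 t).space := by
    refine isCompact_Icc.induction_on
      (p := fun s => ∃ Y : Submodule ℝ H, FiniteDimensional ℝ Y ∧
        ∀ t ∈ s, CleanAlong Y.subtypeₗᵢ (𝓛 t).space) ?_ ?_ ?_ ?_
    · exact ⟨⊥, inferInstance, by simp⟩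
    · rintro s s' hs ⟨Y, hY, h⟩
      exact ⟨Y, hY, fun t ht => h t (hs ht)⟩
    · rintro s s' ⟨Y, hY, h⟩ ⟨Z, hZ, h'⟩
      refine ⟨Y ⊔ Z, inferInstance, ?_⟩
      rintro t (ht | ht)
      · exact (h t ht).mono le_sup_left
      · exact (h' t ht).mono le_sup_right
    · intro t ht
      obtain ⟨Y, hY, c, hc, h⟩ := exists_cleanAlong_of_fredholm (hfred t ht)
      refine ⟨_, hcont t ht (Metric.ball_mem_nhds _ (half_pos hc)), Y, hY, fun s hs => ?_⟩
      refine ⟨c / 2, half_pos hc, h.of_dist_le ?_⟩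
      rw [dist_comm]
      exact (Metric.mem_ball.1 hs).le
  refine ⟨Yᗮ, ?_, Submodule.isClosed_orthogonal _, fun t ht =>
    (cleanAlong_subtype_iff Y _).1 (h t ht)⟩
  exact Submodule.FG.cofg_of_isCompl Y.isCompl_orthogonal
    (Module.Finite.iff_fg.1 hY)

variable {a b : ℝ} {𝓛 : ℝ → LagrangianGrassmannian H} {I J : Submodule ℝ H}

theorem IsCleanFor.cleanAlong (h : IsCleanFor I 𝓛 a b) {t : ℝ} (ht : t ∈ Icc a b) :
    CleanAlong Iᗮ.subtypeₗᵢ (𝓛 t).space :=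
  (cleanAlong_orthogonal_iff h.isClosed _).2 (h.clean t ht)

theorem IsCleanFor.inf (hI : IsCleanFor I 𝓛 a b) (hJ : IsCleanFor J 𝓛 a b) :
    IsCleanFor (I ⊓ J) 𝓛 a b := by
  have hcl : IsClosed ((I ⊓ J : Submodule ℝ H) : Set H) := hI.isClosed.inter hJ.isClosed
  exact ⟨hcl, fun t ht => (cleanAlong_orthogonal_iff hcl _).1
    ((hI.cleanAlong ht).mono (Submodule.orthogonal_le inf_le_left))⟩

/-- The symplectic reduction of the path `𝓛` modulo `I × {0}`. -/
noncomputable def reducedPath (I : Submodule ℝ H) (𝓛 : ℝ → LagrangianGrassmannian H) (t : ℝ) :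
    LagrangianGrassmannian Iᗮ :=
  reducePoint Iᗮ.subtypeₗᵢ (𝓛 t)

theorem IsCleanFor.space_reducedPath (h : IsCleanFor I 𝓛 a b) {t : ℝ} (ht : t ∈ Icc a b) :
    (reducedPath I 𝓛 t).space = reduce Iᗮ.subtypeₗᵢ (𝓛 t).space :=
  space_reducePoint (h.cleanAlong ht)

theorem IsCleanFor.isReducedPath (h : IsCleanFor I 𝓛 a b) :
    IsReducedPath I 𝓛 a b (reducedPath I 𝓛) := fun t ht => by
  rw [h.space_reducedPath ht, horizontalReduction_eq_reduce]

theorem IsCleanFor.continuousOn_reducedPath (h : IsCleanFor I 𝓛 a b)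
    (hcont : ContinuousOn 𝓛 (Icc a b)) : ContinuousOn (reducedPath I 𝓛) (Icc a b) :=
  (continuousOn_reducePoint _).comp hcont fun _ ht => h.cleanAlong ht

theorem IsCleanFor.isTransverse_reducedPath (h : IsCleanFor I 𝓛 a b) {t : ℝ} (ht : t ∈ Icc a b)
    (htr : IsTransverse (𝓛 t).space (horizontalFrame H)) :
    IsTransverse (reducedPath I 𝓛 t).space (horizontalFrame Iᗮ) := by
  rw [h.space_reducedPath ht]
  exact htr.reduce _

variable [FiniteDimensional ℝ (H ⧸ I)] [FiniteDimensional ℝ (H ⧸ J)]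

/-- Reducing to `J^⊥` factors through `I^⊥`, and cleanness for `J` descends to the reduced path in
`Λ(I^⊥)`. -/
theorem IsCleanFor.maslovIndex_eq_of_le (hab : a ≤ b) (hI : IsCleanFor I 𝓛 a b)
    (hJ : IsCleanFor J 𝓛 a b) (hIJ : I ≤ J) {m m' : ℤ}
    (hm : IsMaslovIndex (frameLagrangian Iᗮ) (reducedPath I 𝓛) a b m)
    (hm' : IsMaslovIndex (frameLagrangian Jᗮ) (reducedPath J 𝓛) a b m') : m = m' := by
  let ψ : Jᗮ →ₗᵢ[ℝ] Iᗮ := ⟨Submodule.inclusion (Submodule.orthogonal_le hIJ), fun _ => rfl⟩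
  have hψ : Iᗮ.subtypeₗᵢ.comp ψ = Jᗮ.subtypeₗᵢ := rfl
  refine hm.eq_of_reduce (φ := ψ) hab (fun t ht => ?_) (fun t ht => ?_) hm'
  · obtain ⟨c, hc, h⟩ := hJ.cleanAlong ht
    rw [hI.space_reducedPath ht]
    exact ⟨c, hc, CleanWith.reduce hc (hψ ▸ h)⟩
  · rw [hI.space_reducedPath ht, hJ.space_reducedPath ht, reduce_reduce, hψ]

/-- The Maslov index of the reduced path does not depend on the subspace. -/
theorem IsCleanFor.maslovIndex_eq (hab : a ≤ b) (hcont : ContinuousOn 𝓛 (Icc a b))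
    (ha : IsTransverse (𝓛 a).space (horizontalFrame H))
    (hb : IsTransverse (𝓛 b).space (horizontalFrame H)) (hI : IsCleanFor I 𝓛 a b)
    (hJ : IsCleanFor J 𝓛 a b) {m m' : ℤ}
    (hm : IsMaslovIndex (frameLagrangian Iᗮ) (reducedPath I 𝓛) a b m)
    (hm' : IsMaslovIndex (frameLagrangian Jᗮ) (reducedPath J 𝓛) a b m') : m = m' := by
  have : FiniteDimensional ℝ (H ⧸ (I ⊓ J)) := Submodule.CoFG.inf ‹_› ‹_›
  have h := hI.inf hJ
  obtain ⟨k, hk⟩ := exists_isMaslovIndex hab (h.continuousOn_reducedPath hcont)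
    (h.isTransverse_reducedPath (left_mem_Icc.2 hab) ha)
    (h.isTransverse_reducedPath (right_mem_Icc.2 hab) hb)
  exact (h.maslovIndex_eq_of_le hab hI inf_le_left hk hm).symm.trans
    (h.maslovIndex_eq_of_le hab hJ inf_le_right hk hm')

end Admissible

/-- A reduced path is prescribed only on `[a, b]`, so the index must not depend on its values
elsewhere. -/
theorem IsMaslovIndex.congr {V : Type*} [NormedAddCommGroup V] [InnerProductSpace ℝ V]
    [FiniteDimensional ℝ V] [CompleteSpace V] {L : LagrangianGrassmannian V}
    {l l' : ℝ → LagrangianGrassmannian V} {a b : ℝ} {m : ℤ} (hab : a ≤ b)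
    (h : IsMaslovIndex L l a b m) (heq : ∀ t ∈ Icc a b, l t = l' t) :
    IsMaslovIndex L l' a b m := by
  have key : ∀ c lbar, IsClosingLoop L l a b c lbar ↔ IsClosingLoop L l' a b c lbar := by
    intro c lbar
    have h0 := heq a (left_mem_Icc.2 hab)
    exact ⟨fun h => ⟨h.le, h.continuousOn, fun t ht => (h.eq t ht).trans (heq t ht), h.transverse,
      h.closed.trans h0⟩, fun h => ⟨h.le, h.continuousOn,
      fun t ht => (h.eq t ht).trans (heq t ht).symm, h.transverse, h.closed.trans h0.symm⟩⟩
  obtain ⟨⟨c, lbar, h1⟩, h2⟩ := h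
  exact ⟨⟨c, lbar, (key c lbar).1 h1⟩, fun c lbar h => h2 c lbar ((key c lbar).2 h)⟩

theorem IsMaslovIndex.unique {V : Type*} [NormedAddCommGroup V] [InnerProductSpace ℝ V]
    [FiniteDimensional ℝ V] [CompleteSpace V] {L : LagrangianGrassmannian V}
    {l : ℝ → LagrangianGrassmannian V} {a b : ℝ} {m m' : ℤ} (hab : a ≤ b)
    (h : IsMaslovIndex L l a b m) (h' : IsMaslovIndex L l a b m') : m = m' := by
  obtain ⟨⟨c, lbar, h1⟩, h2⟩ := h
  exact (h2 c lbar h1).unique (hab.trans h1.le) (h'.2 c lbar h1)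

end FredholmMaslov

theorem proposition3 {H : Type*} [NormedAddCommGroup H] [InnerProductSpace ℝ H] [CompleteSpace H]
    (a b : ℝ) (hab : a ≤ b) (𝓛 : ℝ → LagrangianGrassmannian H)
    (hcont : ContinuousOn 𝓛 (Set.Icc a b))
    (hfred : ∀ t ∈ Set.Icc a b, 𝓛 t ∈ fredholmLagrangianGrassmannian H)
    (ha : IsTransverse (𝓛 a).space (horizontalFrame H))
    (hb : IsTransverse (𝓛 b).space (horizontalFrame H)) :
    (∃ I : Submodule ℝ H, FiniteDimensional ℝ (H ⧸ I) ∧ IsCleanFor I 𝓛 a b) ∧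
      ∃! m : ℤ, ∀ (I : Submodule ℝ H) [FiniteDimensional ℝ (H ⧸ I)], IsCleanFor I 𝓛 a b →
        ∃ l : ℝ → LagrangianGrassmannian Iᗮ,
          IsReducedPath I 𝓛 a b l ∧
          ContinuousOn l (Set.Icc a b) ∧
          IsTransverse (l a).space (horizontalFrame Iᗮ) ∧
          IsTransverse (l b).space (horizontalFrame Iᗮ) ∧
          IsMaslovIndex (frameLagrangian Iᗮ) l a b m := by
  have hex := exists_isCleanFor hcont hfred
  refine ⟨hex, ?_⟩
  have index : ∀ (J : Submodule ℝ H) [FiniteDimensional ℝ (H ⧸ J)], IsCleanFor J 𝓛 a b →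
      ∃ m, IsMaslovIndex (frameLagrangian Jᗮ) (reducedPath J 𝓛) a b m := fun J _ hJ =>
    exists_isMaslovIndex hab (hJ.continuousOn_reducedPath hcont)
      (hJ.isTransverse_reducedPath (Set.left_mem_Icc.2 hab) ha)
      (hJ.isTransverse_reducedPath (Set.right_mem_Icc.2 hab) hb)
  obtain ⟨I, hfin, hI⟩ := hex
  obtain ⟨m, hm⟩ := index I hI
  refine ⟨m, fun J _ hJ => ?_, fun m' hm' => ?_⟩
  · obtain ⟨k, hk⟩ := index J hJ
    obtain rfl := hI.maslovIndex_eq hab hcont ha hb hJ hm hk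
    exact ⟨reducedPath J 𝓛, hJ.isReducedPath, hJ.continuousOn_reducedPath hcont,
      hJ.isTransverse_reducedPath (Set.left_mem_Icc.2 hab) ha,
      hJ.isTransverse_reducedPath (Set.right_mem_Icc.2 hab) hb, hk⟩
  -- Uniqueness needs the admissible `I` found above: without one the condition on `m'` would be
  -- vacuous.
  · obtain ⟨l, hl, -, -, -, hml⟩ := hm' I hI
    refine (hml.congr hab fun t ht => ?_).unique hab hm
    exact Subtype.ext ((hl t ht).trans (hI.isReducedPath t ht).symm)
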